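/- **Setting.** Let $G$ be a directed graph with finite edge set $E$, and let $I$ be a finite set of $N\ge 1$ origin/destination (O/D) pairs. The pair $i$ has a traffic demand $m_i>0$ and a finite non-empty set $\mathcal P_i$ of simple paths from its origin to its destination. Put $\|m\|_1=\sum_i m_i$, $M=\max_i m_i$ and $P=\sum_i|\mathcal P_i|$. A feasible flow is a vector $f\in\mathbb R_{\ge 0}^{P}$ with $\sum_{p\in\mathcal P_i}f_p=m_i$ for all $i$; $\mathcal F$ is the set of feasible flows, and $x_e(f)=\sum_{p\ni e}f_p$ is the load of the edge $e$. The network has a random state $\omega\in\Omega$ with law $\mathbb P$. The cost $c_e(x,\omega)$ of an edge is measurable in $\omega$ and, for $x\in[0,\|m\|_1]$, nonnegative, bounded, non-decreasing in $x$ and Lipschitz in $x$ (uniformly in $\omega$). Write $c_p(f,\omega)=\sum_{e\in p}c_e(x_e(f),\omega)$, $c(f,\omega)=(c_p(f,\omega))_p$, $\bar c(f)=\mathbb E_\omega[c(f,\omega)]$ and $\bar c_e(x)=\mathbb E_\omega[c_e(x,\omega)]$. Let $$\bar\Phi(f)=\sum_e\int_0^{x_e(f)}\bar c_e(u)\,du,\qquad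 \mathrm{Gap}(f)=\bar\Phi(f)-\min_{\mathcal F}\bar\Phi,\qquad \sigma^2=\sup_{f\in\mathcal F}\mathbb E_\omega\|c(f,\omega)-\bar c(f)\|_\infty^2 .$$ Let $L\ge 0$ be a smoothness modulus of $\bar\Phi$, i.e. its gradient $\nabla\bar\Phi=\bar c$ satisfies $\|\bar c(f)-\bar c(f')\|_\infty\le L\|f-f'\|_1$ on $\mathcal F$. **AdaWeight.** Let $\Lambda(Y)_p=m_i\,e^{Y_p}/\sum_{q\in\mathcal P_i}e^{Y_q}$ for $p\in\mathcal P_i$. Take step weights $\alpha_t=t$ and start with $Y^1=0$, $\eta^1=1$. In each epoch $t=1,2,\dots$, with anchor $a^t=\sum_{s<t}\alpha_s y^s$ and $A_t=\sum_{s\le t}\alpha_s$: 1. (test) form the test flow $\tilde x^t=(\alpha_t\Lambda(\eta^tY^t)+a^t)/A_t$, observe $\tilde c^t=c(\tilde x^t,\tilde\omega^t)$ and set $\tilde Y^t=Y^t-\alpha_t\tilde c^t$; 2. (recommendation) set $y^t=\Lambda(\eta^t\tilde Y^t)$, recommend $x^t=(\alpha_ty^t+a^t)/A_t$, observe $c^t=c(x^t,\omega^t)$,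 and set $Y^{t+1}=Y^t-\alpha_tc^t$ and $\eta^{t+1}=\bigl(1+\sum_{s\le t}\|\alpha_s(c^s-\tilde c^s)\|_\infty^2\bigr)^{-1/2}$. The states $\tilde\omega^1,\omega^1,\tilde\omega^2,\omega^2,\dots$ are i.i.d. with law $\mathbb P$. **Theorem.** Let $$C=NM\Bigl[2\log\frac{PM}{\|m\|_1}+13\Bigr]>0,\qquad C'=\|m\|_1\log\frac{PM}{\|m\|_1}\ge 0 .$$ Then for every $T\ge 1$ the random variable $\mathrm{Gap}(x^T)$ is integrable and $$\mathbb E[\mathrm{Gap}(x^T)]\le\frac{2\sqrt2\,C\sigma}{\sqrt T}+\frac{16L\sqrt{NM}\,C^{3/2}+2C'}{T^2}.$$ In the static case $\sigma=0$, almost surely, $\mathrm{Gap}(x^T)\le(16L\sqrt{NM}\,C^{3/2}+2C')/T^2$ for all $T\ge1$. Moreover, there is a constant $K>0$ that depends only on $N$, $M$ and $L$ such that, whenever $P\ge2$: $C\le K\log P$ and $C'\le K\log P$; for all $T\ge 1$, $\mathbb E[\mathrm{Gap}(x^T)]\le K(\log P)^{3/2}\bigl(\sigma/\sqrt T+1/T^2\bigr)$;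 and, if $\sigma=0$, almost surely $\mathrm{Gap}(x^T)\le K(\log P)^{3/2}/T^2$ for all $T\ge1$. -/

import Mathlib

open MeasureTheory ProbabilityTheory

noncomputable section

/-- In the directed graph with edge set `E` and endpoint maps `tail`, `head`, the list of edges `l`
is a walk from `u` to `v`. -/
def IsWalk {V E : Type*} (tail head : E → V) : V → V → List E → Prop
  | u, v, [] => u = v
  | u, v, e :: l => tail e = u ∧ IsWalk tail head (head e) v l

/-- A (simple) path from `u` to `v`: a walk that visits no vertex twice. -/
def IsSimplePath {V E : Type*} (tail head : E → V) (u v : V) (l : List E) : Prop :=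
  IsWalk tail head u v l ∧ (l.map tail ++ [v]).Nodup

/-- A nonatomic congestion game with random costs on the directed (multi)graph with vertices `V` and
edges `E`. `I` is the set of O/D pairs and `Ω` the set of states of the network, with law `law`.
`cost e x s` is the cost of edge `e` under load `x` in state `s`; only loads between `0` and the
total demand can occur, so the regularity of the costs is required on that interval only. -/
structure CongestionGame (V E I Ω : Type*) [Fintype I] [MeasurableSpace Ω] where
  tail : E → V
  head : E → V
  origin : I → V
  dest : I → V
  /-- the traffic demand of each O/D pair -/
  demand : I → ℝ
  demand_pos : ∀ i, 0 < demand i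
  /-- the set of paths that may be recommended to the traffic of each O/D pair -/
  paths : I → Finset (List E)
  paths_nonempty : ∀ i, (paths i).Nonempty
  isPath : ∀ i, ∀ p ∈ paths i, IsSimplePath tail head (origin i) (dest i) p
  law : Measure Ω
  isProbabilityMeasure_law : IsProbabilityMeasure law
  cost : E → ℝ → Ω → ℝ
  cost_measurable : ∀ e, ∀ x ∈ Set.Icc 0 (∑ i, demand i), Measurable (cost e x)
  cost_monotone : ∀ e s, MonotoneOn (fun x => cost e x s) (Set.Icc 0 (∑ i, demand i))
  cost_nonneg : ∀ e s, ∀ x ∈ Set.Icc 0 (∑ i, demand i), 0 ≤ cost e x s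
  cost_bounded : ∃ H : ℝ, ∀ e s, ∀ x ∈ Set.Icc 0 (∑ i, demand i), cost e x s ≤ H
  cost_lipschitz : ∃ K : NNReal, ∀ e s,
    LipschitzOnWith K (fun x => cost e x s) (Set.Icc 0 (∑ i, demand i))

/-- The two phases of an epoch of the algorithm, each of which queries the network once. -/
inductive Phase
  | test
  | recommend

namespace CongestionGame

variable {V E I Ω : Type*} [Fintype E] [Fintype I] [MeasurableSpace Ω]
  (G : CongestionGame V E I Ω)

/-- The paths of all O/D pairs, each labelled with its O/D pair. -/
abbrev Route : Type _ := (i : I) × {p : List E // p ∈ G.paths i}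

/-- `P`, the number of paths. -/
def numPaths : ℕ := Fintype.card G.Route

/-- `‖m‖₁`, the total demand. -/
def totalDemand : ℝ := ∑ i, G.demand i

/-- `M`, the largest demand. -/
def maxDemand : ℝ := ⨆ i, G.demand i

/-- The feasible flows. -/
def feasible : Set (G.Route → ℝ) :=
  {f | (∀ r, 0 ≤ f r) ∧ ∀ i, ∑ p : {p : List E // p ∈ G.paths i}, f ⟨i, p⟩ = G.demand i}

open scoped Classical in
/-- The load of the edge `e` under the flow `f`. -/
def load (f : G.Route → ℝ) (e : E) : ℝ :=
  ∑ r : G.Route, if e ∈ r.2.1 then f r else 0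

/-- The vector of path costs under the flow `f` in state `s`. -/
def pathCost (f : G.Route → ℝ) (s : Ω) : G.Route → ℝ :=
  fun r => (r.2.1.map fun e => G.cost e (G.load f e) s).sum

/-- The vector of mean path costs under the flow `f`; it is the gradient of `potential` at `f`. -/
def meanPathCost (f : G.Route → ℝ) : G.Route → ℝ :=
  fun r => ∫ s, G.pathCost f s r ∂G.law

/-- The mean cost of the edge `e` under the load `x`. -/
def meanCost (e : E) (x : ℝ) : ℝ := ∫ s, G.cost e x s ∂G.law

/-- The mean Beckmann-McGuire-Winsten potential. -/
def potential (f : G.Route → ℝ) : ℝ := ∑ e, ∫ u in (0 : ℝ)..G.load f e, G.meanCost e u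

/-- The equilibrium gap of a flow. -/
def gap (f : G.Route → ℝ) : ℝ := G.potential f - sInf (G.potential '' G.feasible)

/-- The potential is `L`-smooth with respect to the `ℓ¹` norm: its gradient, the vector of mean path
costs, is `L`-Lipschitz from the `ℓ¹` norm to the supremum norm. -/
def IsSmoothWith (L : ℝ) : Prop :=
  ∀ f ∈ G.feasible, ∀ g ∈ G.feasible,
    ‖G.meanPathCost f - G.meanPathCost g‖ ≤ L * ∑ r, |f r - g r|

/-- `σ`, where `σ²` is the supremum over all feasible flows of the variance of the path costs in the
supremum norm. -/
def noiseLevel : ℝ :=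
  √(⨆ f : G.feasible, ∫ s, ‖G.pathCost f s - G.meanPathCost f‖ ^ 2 ∂G.law)

/-- The logit map. -/
def logit (Y : G.Route → ℝ) : G.Route → ℝ :=
  fun r => G.demand r.1 * Real.exp (Y r) /
    ∑ q : {p : List E // p ∈ G.paths r.1}, Real.exp (Y ⟨r.1, q⟩)

/-- What AdaWeight remembers at the start of epoch `t`: the anchor `∑_{s < t} αₛ yˢ`, the path scores
`Yᵗ`, and the sum `∑_{s < t} ‖αₛ (cˢ - c̃ˢ)‖²` that determines the learning rate. -/
structure Memory where
  anchor : G.Route → ℝ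
  score : G.Route → ℝ
  sqSum : ℝ

namespace Memory

variable {G}
variable (m : G.Memory) (α : ℕ → ℝ) (t : ℕ)

/-- the learning rate `ηᵗ` -/
def rate : ℝ := 1 / √(1 + m.sqSum)

/-- `(αₜ y + anchor) / ∑_{s ≤ t} αₛ` -/
def average (y : G.Route → ℝ) : G.Route → ℝ :=
  (∑ s ∈ Finset.range (t + 1), α s)⁻¹ • (α t • y + m.anchor)

/-- the test flow of epoch `t` -/
def testFlow : G.Route → ℝ := m.average α t (G.logit (m.rate • m.score))

/-- the exploratory scores of epoch `t`, when the test flow is queried in state `s₁` -/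
def testScore (s₁ : Ω) : G.Route → ℝ := m.score - α t • G.pathCost (m.testFlow α t) s₁

/-- the leading flow `yᵗ` of the recommendation phase -/
def leadFlow (s₁ : Ω) : G.Route → ℝ := G.logit (m.rate • m.testScore α t s₁)

/-- the recommended flow `xᵗ` -/
def recommendedFlow (s₁ : Ω) : G.Route → ℝ := m.average α t (m.leadFlow α t s₁)

/-- The memory after epoch `t`, in which the test flow is queried in state `s₁` and the traffic is
routed according to the recommended flow in state `s₂`. -/
def next (s₁ s₂ : Ω) : G.Memory where
  anchor := m.anchor + α t • m.leadFlow α t s₁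
  score := m.score - α t • G.pathCost (m.recommendedFlow α t s₁) s₂
  sqSum := m.sqSum + ‖α t • (G.pathCost (m.recommendedFlow α t s₁) s₂ -
    G.pathCost (m.testFlow α t) s₁)‖ ^ 2

end Memory

/-- The memory of AdaWeight with step weights `α` after the epochs `1, …, n`, when `s t φ` is the
state of the network in phase `φ` of epoch `t`. -/
def memory (α : ℕ → ℝ) (s : ℕ → Phase → Ω) : ℕ → G.Memory
  | 0 => ⟨0, 0, 0⟩
  | n + 1 => (memory α s n).next α (n + 1) (s (n + 1) Phase.test) (s (n + 1) Phase.recommend)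

/-- The flow that AdaWeight with step weights `α` recommends in epoch `t ≥ 1`. -/
def adaWeight (α : ℕ → ℝ) (s : ℕ → Phase → Ω) (t : ℕ) : G.Route → ℝ :=
  (G.memory α s (t - 1)).recommendedFlow α t (s t Phase.test)

/-- `C = N M (2 log (P M / ‖m‖₁) + 13)` -/
def constC : ℝ :=
  Fintype.card I * G.maxDemand *
    (2 * Real.log (G.numPaths * G.maxDemand / G.totalDemand) + 13)

/-- `C' = ‖m‖₁ log (P M / ‖m‖₁)` -/
def constC' : ℝ :=
  G.totalDemand * Real.log (G.numPaths * G.maxDemand / G.totalDemand)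

end CongestionGame

end

/-! AdaWeight is an accelerated extragradient method with entropic regularization. Write A_t for the
sum of the first t step weights. The anchor after epoch t equals A_t x^t, so x^t is the weighted
average of the leading flows y^s, s ≤ t, and costs are observed at this average. Convexity of the
potential Φ at x^t, used against x^{t-1} and against a competitor f, gives A_t (Φ(x^t) - Φ(f)) ≤
A_{t-1} (Φ(x^{t-1}) - Φ(f)) + α_t ⟨c̄(x^t), y^t - f⟩. Hence the weighted linear regret of the y^t
bounds A_T (Φ(x^T) - Φ(f)) (`weight_mul_potential_sub_le`), and A_T ≥ T²/2.

The regret for the observed costs is tracked by (F(ηY) - F(0))/η, where F is the log-partition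
function, whose gradient is the logit map. The Bregman divergence of F is a relative entropy and so
dominates a squared ℓ¹ distance. One epoch then costs at most 4‖m‖₁ times the increase of 1/η and
gains d_t²/(4‖m‖₁η), where d_t is the ℓ¹ distance between the leading flows of the two phases
(`regretPotential_next_le`). Summing leaves C' + (C/2)(1/η - 1) minus the gains (`regret_le`).

The test and the recommended flow differ by α_t/A_t times the difference of the leading flows, and
α_t²/A_t ≤ 2. By smoothness, the quantity α_t‖c^t - c̃^t‖ that drives 1/η is at most 2L d_t plus
noise (`norm_cost_sub_le`). Beyond a threshold of order L√(‖m‖₁C), the gains pay for the growth of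
1/η that smoothness allows; only the part below the threshold and the noise remain
(`half_mul_sqrt_sub_le`). The former yields the 1/T² term, the latter a contribution of mean order
σT^{3/2} before division by A_T. The rest of the regret is a martingale term with mean zero for each
fixed f, because the recommendation state is independent of (x^t, y^t). -/

noncomputable section

/-! ### Relative entropy, the logit map and the constants C, C' -/

/-- A lower bound on the relative entropy of two positive vectors with the same mass `c`, in terms
of their `ℓ¹` distance. -/
theorem sq_sum_abs_sub_le_four_mul_sum_mul_log {ι : Type*} [Fintype ι] {y z : ι → ℝ} {c : ℝ}
    (hy : ∀ r, 0 < y r) (hz : ∀ r, 0 < z r) (hyc : ∑ r, y r = c) (hzc : ∑ r, z r = c) :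
    (∑ r, |y r - z r|) ^ 2 ≤ 4 * c * ∑ r, y r * (Real.log (y r) - Real.log (z r)) := by
  -- Cauchy-Schwarz on this factorization bounds the ℓ¹ distance by the Hellinger distance, which
  -- the relative entropy dominates. The constant 4 is twice that of Pinsker's inequality.
  have habs : ∀ r, |y r - z r| = |√(y r) - √(z r)| * (√(y r) + √(z r)) := fun r => by
    rw [← abs_of_nonneg (add_nonneg (Real.sqrt_nonneg (y r)) (Real.sqrt_nonneg (z r))), ← abs_mul]
    congr 1
    linear_combination -(Real.sq_sqrt (hy r).le) + Real.sq_sqrt (hz r).le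
  have hent : ∑ r, |√(y r) - √(z r)| ^ 2 ≤
      ∑ r, y r * (Real.log (y r) - Real.log (z r)) := by
    -- This is log x ≤ x - 1 at x = √z/√y, multiplied by 2y. The terms -y + z cancel on summation
    -- because the masses agree.
    have hterm : ∀ r, |√(y r) - √(z r)| ^ 2 ≤
        y r * (Real.log (y r) - Real.log (z r)) - y r + z r := fun r => by
      have hys := Real.sqrt_pos.2 (hy r)
      have hzs := Real.sqrt_pos.2 (hz r)
      have hlog := Real.log_le_sub_one_of_pos (div_pos hzs hys)
      rw [Real.log_div hzs.ne' hys.ne', Real.log_sqrt (hz r).le, Real.log_sqrt (hy r).le] at hlog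
      have hmul := mul_le_mul_of_nonneg_left hlog (hy r).le
      have hdiv : y r * (√(z r) / √(y r) - 1) = √(y r) * √(z r) - y r := by
        field_simp
        linear_combination √(z r) * (Real.sq_sqrt (hy r).le).symm
      rw [sq_abs]
      nlinarith [Real.sq_sqrt (hy r).le, Real.sq_sqrt (hz r).le]
    calc ∑ r, |√(y r) - √(z r)| ^ 2
        ≤ ∑ r, (y r * (Real.log (y r) - Real.log (z r)) - y r + z r) :=
          Finset.sum_le_sum fun r _ => hterm r
      _ = ∑ r, y r * (Real.log (y r) - Real.log (z r)) := by
          rw [Finset.sum_add_distrib, Finset.sum_sub_distrib, hyc, hzc]; ring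
  have hsum : ∑ r, (√(y r) + √(z r)) ^ 2 ≤ 4 * c :=
    calc ∑ r, (√(y r) + √(z r)) ^ 2 ≤ ∑ r, (2 * y r + 2 * z r) :=
          Finset.sum_le_sum fun r _ => by
            nlinarith [Real.sq_sqrt (hy r).le, Real.sq_sqrt (hz r).le, sq_nonneg (√(y r) - √(z r))]
      _ = 4 * c := by
          rw [Finset.sum_add_distrib, ← Finset.mul_sum, ← Finset.mul_sum, hyc, hzc]; ring
  have h0 : 0 ≤ ∑ r, |√(y r) - √(z r)| ^ 2 := Finset.sum_nonneg fun r _ => by positivity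
  calc (∑ r, |y r - z r|) ^ 2 = (∑ r, |√(y r) - √(z r)| * (√(y r) + √(z r))) ^ 2 := by
        simp only [habs]
    _ ≤ (∑ r, |√(y r) - √(z r)| ^ 2) * ∑ r, (√(y r) + √(z r)) ^ 2 :=
        Finset.sum_mul_sq_le_sq_mul_sq _ _ _
    _ ≤ (∑ r, |√(y r) - √(z r)| ^ 2) * (4 * c) := mul_le_mul_of_nonneg_left hsum h0
    _ ≤ (∑ r, y r * (Real.log (y r) - Real.log (z r))) * (4 * c) :=
        mul_le_mul_of_nonneg_right hent
          (le_trans (Finset.sum_nonneg fun r _ => by positivity) hsum)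
    _ = _ := mul_comm _ _

namespace CongestionGame

variable {V E I Ω : Type*} [Fintype I] [MeasurableSpace Ω] (G : CongestionGame V E I Ω)

instance (i : I) : Nonempty {p : List E // p ∈ G.paths i} :=
  (G.paths_nonempty i).to_subtype

theorem sum_of_mem_feasible {f : G.Route → ℝ} (hf : f ∈ G.feasible) :
    ∑ r, f r = G.totalDemand := by
  rw [Fintype.sum_sigma]
  exact Finset.sum_congr rfl fun i _ => hf.2 i

theorem totalDemand_pos [Nonempty I] : 0 < G.totalDemand :=
  Finset.sum_pos (fun i _ => G.demand_pos i) Finset.univ_nonempty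

theorem totalDemand_nonneg : 0 ≤ G.totalDemand :=
  Finset.sum_nonneg fun i _ => (G.demand_pos i).le

theorem sum_abs_sub_le_of_mem_feasible {f g : G.Route → ℝ} (hf : f ∈ G.feasible)
    (hg : g ∈ G.feasible) : ∑ r, |f r - g r| ≤ 2 * G.totalDemand :=
  calc ∑ r, |f r - g r| ≤ ∑ r, (f r + g r) := Finset.sum_le_sum fun r _ => by
        rw [abs_le]; constructor <;> linarith [hf.1 r, hg.1 r]
    _ = 2 * G.totalDemand := by
        rw [Finset.sum_add_distrib, G.sum_of_mem_feasible hf, G.sum_of_mem_feasible hg]; ring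

theorem convex_feasible : Convex ℝ G.feasible := by
  intro f hf g hg a b ha hb hab
  refine ⟨fun r => ?_, fun i => ?_⟩
  · exact add_nonneg (mul_nonneg ha (hf.1 r)) (mul_nonneg hb (hg.1 r))
  · simp only [Pi.add_apply, Pi.smul_apply, smul_eq_mul]
    rw [Finset.sum_add_distrib, ← Finset.mul_sum, ← Finset.mul_sum, hf.2, hg.2, ← add_mul, hab,
      one_mul]

theorem sum_exp_pos (Y : G.Route → ℝ) (i : I) :
    0 < ∑ q : {p : List E // p ∈ G.paths i}, Real.exp (Y ⟨i, q⟩) :=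
  Finset.sum_pos (fun _ _ => Real.exp_pos _) Finset.univ_nonempty

theorem logit_pos (Y : G.Route → ℝ) (r : G.Route) : 0 < G.logit Y r :=
  div_pos (mul_pos (G.demand_pos _) (Real.exp_pos _)) (G.sum_exp_pos Y r.1)

theorem logit_mem_feasible (Y : G.Route → ℝ) : G.logit Y ∈ G.feasible := by
  refine ⟨fun r => (G.logit_pos Y r).le, fun i => ?_⟩
  have h : ∀ p, G.logit Y ⟨i, p⟩ = G.demand i * Real.exp (Y ⟨i, p⟩) /
      ∑ q : {p : List E // p ∈ G.paths i}, Real.exp (Y ⟨i, q⟩) := fun _ => rfl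
  simp_rw [h]
  rw [← Finset.sum_div, ← Finset.mul_sum, mul_div_assoc, div_self (G.sum_exp_pos Y i).ne', mul_one]

/-- The convex potential of the logit map. -/
def logPartition (Y : G.Route → ℝ) : ℝ :=
  ∑ i, G.demand i * Real.log (∑ q : {p : List E // p ∈ G.paths i}, Real.exp (Y ⟨i, q⟩))

theorem log_logit (Y : G.Route → ℝ) (r : G.Route) :
    Real.log (G.logit Y r) = Real.log (G.demand r.1) + Y r -
      Real.log (∑ q : {p : List E // p ∈ G.paths r.1}, Real.exp (Y ⟨r.1, q⟩)) := by
  rw [logit, Real.log_div (mul_pos (G.demand_pos _) (Real.exp_pos _)).ne' (G.sum_exp_pos Y r.1).ne',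
    Real.log_mul (G.demand_pos _).ne' (Real.exp_pos _).ne', Real.log_exp]

theorem sum_mul_fst_of_mem_feasible {f : G.Route → ℝ} (hf : f ∈ G.feasible) (a : I → ℝ) :
    ∑ r, f r * a r.1 = ∑ i, G.demand i * a i := by
  rw [Fintype.sum_sigma]
  refine Finset.sum_congr rfl fun i _ => ?_
  simp only
  rw [← Finset.sum_mul, hf.2 i]

/-- The Bregman divergence of `logPartition` is the relative entropy of the logit flows: log-demands
cancel, and the normalizing terms depend only on the O/D pair, whose mass is fixed. -/
theorem logPartition_eq_add (a b : G.Route → ℝ) :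
    G.logPartition b = G.logPartition a + ∑ r, G.logit a r * (b r - a r) +
      ∑ r, G.logit a r * (Real.log (G.logit a r) - Real.log (G.logit b r)) := by
  have ha := G.sum_mul_fst_of_mem_feasible (G.logit_mem_feasible a) fun i =>
    Real.log (∑ q : {p : List E // p ∈ G.paths i}, Real.exp (a ⟨i, q⟩))
  have hb := G.sum_mul_fst_of_mem_feasible (G.logit_mem_feasible a) fun i =>
    Real.log (∑ q : {p : List E // p ∈ G.paths i}, Real.exp (b ⟨i, q⟩))
  rw [logPartition, logPartition, ← ha, ← hb, ← Finset.sum_add_distrib, ← Finset.sum_add_distrib]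
  refine Finset.sum_congr rfl fun r _ => ?_
  rw [log_logit, log_logit]
  ring

/-- The supporting-line inequality, sharpened by the distance of the gradients. The quadratic term
is the source of every negative term in the regret bound. -/
theorem logPartition_add_le [Nonempty I] (a b : G.Route → ℝ) :
    G.logPartition a + ∑ r, G.logit a r * (b r - a r) +
      (∑ r, |G.logit a r - G.logit b r|) ^ 2 / (4 * G.totalDemand) ≤ G.logPartition b := by
  rw [G.logPartition_eq_add a b]
  gcongr
  rw [div_le_iff₀ (mul_pos four_pos G.totalDemand_pos), mul_comm]
  exact sq_sum_abs_sub_le_four_mul_sum_mul_log (G.logit_pos a) (G.logit_pos b)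
    (G.sum_of_mem_feasible (G.logit_mem_feasible a))
    (G.sum_of_mem_feasible (G.logit_mem_feasible b))

/-- Each score is at most the log-sum-exp of its O/D pair. This is how a fixed competitor enters the
regret bound. -/
theorem sum_mul_le_logPartition {f : G.Route → ℝ} (hf : f ∈ G.feasible) (Y : G.Route → ℝ) :
    ∑ r, Y r * f r ≤ G.logPartition Y := by
  rw [logPartition, ← G.sum_mul_fst_of_mem_feasible hf fun i =>
    Real.log (∑ q : {p : List E // p ∈ G.paths i}, Real.exp (Y ⟨i, q⟩))]
  refine Finset.sum_le_sum fun r _ => ?_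
  rw [mul_comm]
  refine mul_le_mul_of_nonneg_left ?_ (hf.1 r)
  rw [Real.le_log_iff_exp_le (G.sum_exp_pos Y r.1)]
  exact Finset.single_le_sum (f := fun q => Real.exp (Y ⟨r.1, q⟩))
    (fun _ _ => (Real.exp_pos _).le) (Finset.mem_univ r.2)

/-- Convexity on the segment from 0 to `Y`, obtained from the supporting line at `θ • Y` evaluated
at both ends. It makes (F(ηY) - F(0))/η monotone in η, so lowering the learning rate never raises
the regret potential. -/
theorem logPartition_smul_le [Nonempty I] {θ : ℝ} (h0 : 0 ≤ θ) (h1 : θ ≤ 1) (Y : G.Route → ℝ) :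
    G.logPartition (θ • Y) - G.logPartition 0 ≤ θ * (G.logPartition Y - G.logPartition 0) := by
  have hm := G.totalDemand_pos
  have hY := G.logPartition_add_le (θ • Y) Y
  have hZ := G.logPartition_add_le (θ • Y) 0
  have hYs : ∑ r, G.logit (θ • Y) r * (Y r - (θ • Y) r) =
      (1 - θ) * ∑ r, G.logit (θ • Y) r * Y r := by
    rw [Finset.mul_sum]
    exact Finset.sum_congr rfl fun r _ => by simp only [Pi.smul_apply, smul_eq_mul]; ring
  have hZs : ∑ r, G.logit (θ • Y) r * ((0 : G.Route → ℝ) r - (θ • Y) r) =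
      -θ * ∑ r, G.logit (θ • Y) r * Y r := by
    rw [Finset.mul_sum]
    exact Finset.sum_congr rfl fun r _ => by
      simp only [Pi.smul_apply, smul_eq_mul, Pi.zero_apply]; ring
  rw [hYs] at hY
  rw [hZs] at hZ
  have hY' := mul_le_mul_of_nonneg_left (le_of_add_le_of_nonneg_left hY (by positivity)) h0
  have hZ' := mul_le_mul_of_nonneg_left (le_of_add_le_of_nonneg_left hZ (by positivity))
    (sub_nonneg.2 h1)
  linarith

theorem demand_le_maxDemand (i : I) : G.demand i ≤ G.maxDemand :=
  le_ciSup (Set.finite_range _).bddAbove i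

theorem maxDemand_pos [Nonempty I] : 0 < G.maxDemand :=
  (G.demand_pos (Classical.arbitrary I)).trans_le (G.demand_le_maxDemand _)

theorem maxDemand_le_totalDemand [Nonempty I] : G.maxDemand ≤ G.totalDemand :=
  ciSup_le fun i => Finset.single_le_sum (f := G.demand) (fun j _ => (G.demand_pos j).le)
    (Finset.mem_univ i)

theorem totalDemand_le : G.totalDemand ≤ Fintype.card I * G.maxDemand := by
  rw [totalDemand, ← nsmul_eq_mul]
  exact Finset.sum_le_card_nsmul _ _ _ fun i _ => G.demand_le_maxDemand i

theorem numPaths_eq : (G.numPaths : ℝ) = ∑ i, ((G.paths i).card : ℝ) := by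
  rw [numPaths, Fintype.card_sigma]
  push_cast
  simp

theorem one_le_card_paths (i : I) : (1 : ℝ) ≤ (G.paths i).card := by
  exact_mod_cast (G.paths_nonempty i).card_pos

theorem sum_demand_mul_card_le :
    ∑ i, G.demand i * ((G.paths i).card : ℝ) ≤ G.numPaths * G.maxDemand := by
  rw [numPaths_eq, Finset.sum_mul]
  exact Finset.sum_le_sum fun i _ => by
    rw [mul_comm]
    exact mul_le_mul_of_nonneg_left (G.demand_le_maxDemand i) (Nat.cast_nonneg _)

theorem totalDemand_le_numPaths_mul : G.totalDemand ≤ G.numPaths * G.maxDemand :=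
  (Finset.sum_le_sum fun i _ => le_mul_of_one_le_right (G.demand_pos i).le
    (G.one_le_card_paths i)).trans G.sum_demand_mul_card_le

theorem log_ratio_nonneg [Nonempty I] :
    0 ≤ Real.log (G.numPaths * G.maxDemand / G.totalDemand) :=
  Real.log_nonneg ((one_le_div G.totalDemand_pos).2 G.totalDemand_le_numPaths_mul)

theorem constC'_nonneg [Nonempty I] : 0 ≤ G.constC' :=
  mul_nonneg G.totalDemand_nonneg G.log_ratio_nonneg

/-- The constant 13 leaves slack: `regret_le` only needs C ≥ 2C' + 8‖m‖₁. -/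
theorem two_mul_constC'_add_le [Nonempty I] :
    2 * G.constC' + 13 * G.totalDemand ≤ G.constC := by
  have h := mul_le_mul_of_nonneg_right G.totalDemand_le
    (add_nonneg (mul_nonneg zero_le_two G.log_ratio_nonneg) (by norm_num : (0 : ℝ) ≤ 13))
  rw [constC, constC']
  linarith

theorem card_mul_maxDemand_le_constC [Nonempty I] :
    Fintype.card I * G.maxDemand ≤ G.constC := by
  refine le_mul_of_one_le_right (mul_nonneg (Nat.cast_nonneg _) G.maxDemand_pos.le) ?_
  linarith [G.log_ratio_nonneg]

theorem constC_pos [Nonempty I] : 0 < G.constC :=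
  (G.totalDemand_pos.trans_le G.totalDemand_le).trans_le G.card_mul_maxDemand_le_constC

/-- Jensen's inequality for the logarithm with weights m_i/‖m‖₁, applied to F(0) = ∑ m_i log |P_i|.
-/
theorem logPartition_zero_le_constC' [Nonempty I] : G.logPartition 0 ≤ G.constC' := by
  have hm := G.totalDemand_pos
  have hJ := strictConcaveOn_log_Ioi.concaveOn.le_map_sum (t := Finset.univ)
    (w := fun i => G.demand i / G.totalDemand) (p := fun i => ((G.paths i).card : ℝ))
    (fun i _ => (div_pos (G.demand_pos i) hm).le)
    (by rw [← Finset.sum_div]; exact div_self hm.ne')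
    (fun i _ => zero_lt_one.trans_le (G.one_le_card_paths i))
  simp only [smul_eq_mul, div_mul_eq_mul_div, ← Finset.sum_div] at hJ
  have hsum : ∑ i, G.demand i * ((G.paths i).card : ℝ) > 0 :=
    Finset.sum_pos (fun i _ => mul_pos (G.demand_pos i)
      (zero_lt_one.trans_le (G.one_le_card_paths i))) Finset.univ_nonempty
  have hlog : Real.log ((∑ i, G.demand i * ((G.paths i).card : ℝ)) / G.totalDemand) ≤
      Real.log (G.numPaths * G.maxDemand / G.totalDemand) :=
    Real.log_le_log (div_pos hsum hm) (by gcongr; exact G.sum_demand_mul_card_le)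
  have h0 : G.logPartition 0 = ∑ i, G.demand i * Real.log ((G.paths i).card : ℝ) := by
    simp [logPartition]
  rw [h0, constC', ← div_le_iff₀' hm]
  exact hJ.trans hlog

end CongestionGame
end

/-! ### Adaptive learning rates and the regret of one epoch -/

noncomputable section

/-- The learning rate lags one epoch behind, so `√S` does not yet contain `a`. If a ≤ 2√S,
completing the square leaves m a²/√S, and √(S + a²) ≤ 3√S turns this into a difference of roots. If
a ≥ 2√S, the bound D ≤ 2m suffices, since √(S + a²) - √S ≥ a/2. -/
theorem mul_sub_sqrt_mul_sq_div_le {S a D m : ℝ} (hS : 0 < S) (ha : 0 ≤ a) (hD : D ≤ 2 * m)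
    (hm : 0 < m) : a * D - √S * D ^ 2 / (4 * m) ≤ 4 * m * (√(S + a ^ 2) - √S) := by
  have hs := Real.sqrt_pos.2 hS
  have hs2 := Real.sq_sqrt hS.le
  have hs' := Real.sqrt_nonneg (S + a ^ 2)
  have hs2' := Real.sq_sqrt (add_nonneg hS.le (sq_nonneg a))
  have hle : √S ≤ √(S + a ^ 2) := Real.sqrt_le_sqrt (by linarith [sq_nonneg a])
  set s := √S
  set s' := √(S + a ^ 2)
  rcases le_total a (2 * s) with h | h
  · have h3 : s' ≤ 3 * s := abs_le_of_sq_le_sq' (by nlinarith) (by positivity) |>.2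
    have hsq : a * D - s * D ^ 2 / (4 * m) ≤ m * (a ^ 2 / s) := by
      have : m * (a ^ 2 / s) - (a * D - s * D ^ 2 / (4 * m)) =
          (2 * m * a - s * D) ^ 2 / (4 * m * s) := by
        field_simp; ring
      have h0 : 0 ≤ (2 * m * a - s * D) ^ 2 / (4 * m * s) := by positivity
      linarith
    refine hsq.trans ?_
    have : a ^ 2 / s ≤ 4 * (s' - s) := by
      rw [div_le_iff₀ hs]
      nlinarith
    nlinarith
  · have h2 : a ≤ s' := Real.le_sqrt_of_sq_le (by linarith)
    have h0 : 0 ≤ s * D ^ 2 / (4 * m) := by positivity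
    nlinarith

/-- An abstract bound for adaptive step sizes: if `aₜ ≤ 2 L dₜ + nₜ`, the negative terms in `dₜ`
compensate the growth of the step size up to the contribution of the noise `nₜ`. -/
theorem half_mul_sqrt_sub_le {L m κ C : ℝ} (hL : 0 ≤ L) (hm : 0 < m) (hmκ : m ≤ κ) (hκC : κ ≤ C)
    {a d ν : ℕ → ℝ} (ha : ∀ k, 0 ≤ a k) (hd : ∀ k, 0 ≤ d k) (hdm : ∀ k, d k ≤ 2 * m)
    (had : ∀ k, a k ≤ 2 * L * d k + ν k) (n : ℕ) :
    C / 2 * (√(1 + ∑ k ∈ Finset.range n, a k ^ 2) - 1) -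
      ∑ k ∈ Finset.range n, √(1 + ∑ j ∈ Finset.range k, a j ^ 2) * d k ^ 2 / (4 * m) ≤
    C / 2 * √(2 * ∑ k ∈ Finset.range n, ν k ^ 2) + 8 * L * √κ * C ^ (3 / 2 : ℝ) := by
  have hκ : 0 < κ := hm.trans_le hmκ
  have hC : 0 < C := hκ.trans_le hκC
  -- The part of `a k ^ 2` that smoothness explains; the remainder is at most 2ν². The cap `a k ^ 2`
  -- keeps `U` below the true sum, so the negative terms formed with `U` are no larger than the
  -- given ones.
  set e : ℕ → ℝ := fun k => min (a k ^ 2) (8 * L ^ 2 * d k ^ 2) with he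
  have he0 : ∀ k, 0 ≤ e k := fun k => le_min (sq_nonneg _) (by positivity)
  set U : ℕ → ℝ := fun k => 1 + ∑ j ∈ Finset.range k, e j with hU
  have hU1 : ∀ k, 1 ≤ U k := fun k => le_add_of_nonneg_right (Finset.sum_nonneg fun j _ => he0 j)
  have hUS : ∀ k, U k ≤ 1 + ∑ j ∈ Finset.range k, a j ^ 2 := fun k => by
    simp only [hU]
    gcongr
    exact min_le_left _ _
  have hC32 : C ^ (3 / 2 : ℝ) = C * √C := by
    rw [Real.sqrt_eq_rpow, ← Real.rpow_one_add' hC.le (by norm_num)]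
    norm_num
  have hsκC : m ≤ √κ * √C := by
    rw [← Real.sqrt_mul hκ.le]
    refine Real.le_sqrt_of_sq_le ?_
    nlinarith
  have hsmC : √(8 * m * C) ≤ 3 * (√κ * √C) := by
    rw [← Real.sqrt_mul hκ.le]
    refine Real.sqrt_le_iff.2 ⟨by positivity, ?_⟩
    rw [mul_pow, Real.sq_sqrt (by positivity)]
    nlinarith [mul_le_mul_of_nonneg_right hmκ hC.le]
  -- The bounds 3 and 6 in units of √κ √C add up to 9, hence 9/2 after the factor C/2; the constant
  -- 8 has room to spare.
  have hQ : C / 2 * (L * √(8 * m * C) + L * (6 * m)) ≤ 8 * L * √κ * C ^ (3 / 2 : ℝ) := by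
    rw [hC32]
    have h1 : L * (√(8 * m * C) + 6 * m) ≤ L * (9 * (√κ * √C)) :=
      mul_le_mul_of_nonneg_left (by linarith) hL
    have h2 : 0 ≤ C * (L * (√κ * √C)) := by positivity
    nlinarith [mul_le_mul_of_nonneg_left h1 hC.le]
  have hmain : ∀ k, C / 2 * (√(U k) - 1) -
      ∑ j ∈ Finset.range k, √(U j) * d j ^ 2 / (4 * m) ≤ 8 * L * √κ * C ^ (3 / 2 : ℝ) := by
    intro k
    induction k with
    | zero =>
      simp only [hU, Finset.range_zero, Finset.sum_empty, add_zero, Real.sqrt_one, sub_self,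
        mul_zero]
      positivity
    | succ k ih =>
      have hUk : U (k + 1) = U k + e k := by simp only [hU, Finset.sum_range_succ]; ring
      have hs : 0 < √(U k) := Real.sqrt_pos.2 (zero_lt_one.trans_le (hU1 k))
      have hs2 := Real.sq_sqrt (zero_le_one.trans (hU1 k))
      have hek : e k ≤ 8 * L ^ 2 * d k ^ 2 := min_le_right _ _
      have hsum0 : 0 ≤ ∑ j ∈ Finset.range (k + 1), √(U j) * d j ^ 2 / (4 * m) :=
        Finset.sum_nonneg fun j _ => by positivity
      -- The threshold at which the gain √U d²/(4m) covers the increment, at most C e/(4√U) with e ≤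
      -- 8L²d². Above it the induction hypothesis carries over; below it the gains are dropped and U
      -- is bounded outright, one further step adding at most 32L²m² because d ≤ 2m.
      rcases le_total (8 * m * L ^ 2 * C) (U k) with h | h
      · have hinc : √(U (k + 1)) - √(U k) ≤ e k / (2 * √(U k)) := by
          rw [sub_le_iff_le_add]
          refine Real.sqrt_le_iff.2 ⟨by have := he0 k; positivity, ?_⟩
          rw [hUk, add_sq, hs2]
          have : 2 * (e k / (2 * √(U k))) * √(U k) = e k := by field_simp
          nlinarith [sq_nonneg (e k / (2 * √(U k)))]
        have hle : C / 2 * (e k / (2 * √(U k))) ≤ √(U k) * d k ^ 2 / (4 * m) := by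
          have hd2 : 0 ≤ d k ^ 2 := sq_nonneg _
          rw [div_mul_div_comm, div_le_div_iff₀ (by positivity) (by positivity)]
          have h1 : C * e k * m ≤ C * (8 * L ^ 2 * d k ^ 2) * m := by gcongr
          have h2 : 8 * m * L ^ 2 * C * d k ^ 2 ≤ √(U k) ^ 2 * d k ^ 2 := by rw [hs2]; gcongr
          nlinarith
        rw [Finset.sum_range_succ]
        nlinarith [mul_le_mul_of_nonneg_left hinc (half_pos hC).le]
      · have h1 : √(U (k + 1)) ≤ L * √(8 * m * C) + L * (6 * m) := by
          refine Real.sqrt_le_iff.2 ⟨by positivity, ?_⟩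
          have hsq : (L * √(8 * m * C)) ^ 2 = 8 * m * L ^ 2 * C := by
            rw [mul_pow, Real.sq_sqrt (by positivity)]; ring
          have hd2 : d k ^ 2 ≤ (2 * m) ^ 2 := pow_le_pow_left₀ (hd k) (hdm k) 2
          have hL2 : 8 * L ^ 2 * d k ^ 2 ≤ 8 * L ^ 2 * (2 * m) ^ 2 := by gcongr
          have hx : 0 ≤ 2 * (L * √(8 * m * C)) * (L * (6 * m)) := by positivity
          rw [add_sq, hsq, hUk]
          nlinarith [sq_nonneg (L * m)]
        have h2 := mul_le_mul_of_nonneg_left h1 (half_pos hC).le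
        linarith
  have hae : ∀ k, a k ^ 2 ≤ e k + 2 * ν k ^ 2 := fun k => by
    rcases min_choice (a k ^ 2) (8 * L ^ 2 * d k ^ 2) with h | h
    · simp only [he, h]
      linarith [sq_nonneg (ν k)]
    · simp only [he, h]
      have := pow_le_pow_left₀ (ha k) (had k) 2
      nlinarith [sq_nonneg (2 * L * d k - ν k)]
  have hsqrt : √(1 + ∑ k ∈ Finset.range n, a k ^ 2) ≤
      √(U n) + √(2 * ∑ k ∈ Finset.range n, ν k ^ 2) := by
    have hν2 : 0 ≤ 2 * ∑ k ∈ Finset.range n, ν k ^ 2 := by positivity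
    refine Real.sqrt_le_iff.2 ⟨by positivity, ?_⟩
    rw [add_sq, Real.sq_sqrt (zero_le_one.trans (hU1 n)), Real.sq_sqrt hν2]
    have hsum : ∑ k ∈ Finset.range n, a k ^ 2 ≤
        ∑ k ∈ Finset.range n, e k + 2 * ∑ k ∈ Finset.range n, ν k ^ 2 := by
      rw [Finset.mul_sum, ← Finset.sum_add_distrib]
      exact Finset.sum_le_sum fun k _ => hae k
    have hx : 0 ≤ 2 * √(U n) * √(2 * ∑ k ∈ Finset.range n, ν k ^ 2) := by positivity
    have hUn : U n = 1 + ∑ k ∈ Finset.range n, e k := rfl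
    linarith
  have hneg : ∑ j ∈ Finset.range n, √(U j) * d j ^ 2 / (4 * m) ≤
      ∑ k ∈ Finset.range n, √(1 + ∑ j ∈ Finset.range k, a j ^ 2) * d k ^ 2 / (4 * m) := by
    gcongr with k
    exact hUS k
  nlinarith [hmain n, mul_le_mul_of_nonneg_left hsqrt (half_pos hC).le]

namespace CongestionGame

variable {V E I Ω : Type*} [Fintype I] [MeasurableSpace Ω]
  (G : CongestionGame V E I Ω)

theorem abs_sum_mul_le {ι : Type*} [Fintype ι] (u v : ι → ℝ) :
    |∑ r, u r * v r| ≤ ‖u‖ * ∑ r, |v r| := by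
  rw [Finset.mul_sum]
  refine (Finset.abs_sum_le_sum_abs _ _).trans (Finset.sum_le_sum fun r _ => ?_)
  rw [abs_mul]
  exact mul_le_mul_of_nonneg_right (norm_le_pi_norm u r) (abs_nonneg _)

namespace Memory

variable {G}

/-- The potential of the regret analysis: the normalized logit potential of the scores. -/
def regretPotential (m : G.Memory) : ℝ :=
  √(1 + m.sqSum) * (G.logPartition (m.rate • m.score) - G.logPartition 0)

/-- The `ℓ¹` distance between the leading flows of the two phases of an epoch. -/
def leadDist (m : G.Memory) (α : ℕ → ℝ) (t : ℕ) (s₁ : Ω) : ℝ :=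
  ∑ r, |m.leadFlow α t s₁ r - G.logit (m.rate • m.score) r|

theorem leadFlow_mem_feasible (m : G.Memory) (α : ℕ → ℝ) (t : ℕ) (s₁ : Ω) :
    m.leadFlow α t s₁ ∈ G.feasible := G.logit_mem_feasible _

theorem leadDist_nonneg (m : G.Memory) (α : ℕ → ℝ) (t : ℕ) (s₁ : Ω) : 0 ≤ m.leadDist α t s₁ :=
  Finset.sum_nonneg fun _ _ => abs_nonneg _

theorem leadDist_le (m : G.Memory) (α : ℕ → ℝ) (t : ℕ) (s₁ : Ω) :
    m.leadDist α t s₁ ≤ 2 * G.totalDemand :=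
  G.sum_abs_sub_le_of_mem_feasible (G.logit_mem_feasible _) (G.logit_mem_feasible _)

/-- The extragradient estimate. Two sharpened supporting-line inequalities at the old rate, one from
the new scores to the test scores and one from those to the old scores, combine to the loss of the
leading flow plus ⟨α(c - c̃), z' - y⟩. The first quadratic term absorbs this cross term at the price
of the growth of 1/η; the second one survives as the gain. -/
theorem regretPotential_next_le [Nonempty I] (m : G.Memory) (hm : 0 ≤ m.sqSum) (α : ℕ → ℝ) (t : ℕ)
    (s₁ s₂ : Ω) :
    (m.next α t s₁ s₂).regretPotential +
      α t * ∑ r, G.pathCost (m.recommendedFlow α t s₁) s₂ r * m.leadFlow α t s₁ r +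
      √(1 + m.sqSum) * m.leadDist α t s₁ ^ 2 / (4 * G.totalDemand) ≤
    m.regretPotential +
      4 * G.totalDemand * (√(1 + (m.next α t s₁ s₂).sqSum) - √(1 + m.sqSum)) := by
  have htot := G.totalDemand_pos
  have hs : 0 < √(1 + m.sqSum) := Real.sqrt_pos.2 (by linarith)
  set c := G.pathCost (m.recommendedFlow α t s₁) s₂ with hc
  set c' := G.pathCost (m.testFlow α t) s₁ with hc'
  set m' := m.next α t s₁ s₂ with hm'
  have hsq : m'.sqSum = m.sqSum + ‖α t • (c - c')‖ ^ 2 := rfl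
  have hscore : m'.score = m.score - α t • c := rfl
  have htest : m.testScore α t s₁ = m.score - α t • c' := rfl
  have hlead : m.leadFlow α t s₁ = G.logit (m.rate • m.testScore α t s₁) := rfl
  have hdist : m.leadDist α t s₁ =
    ∑ r, |m.leadFlow α t s₁ r - G.logit (m.rate • m.score) r| := rfl
  have hrate : √(1 + m.sqSum) * m.rate = 1 := by rw [rate]; field_simp
  have hle : √(1 + m.sqSum) ≤ √(1 + m'.sqSum) := by
    rw [hsq]; exact Real.sqrt_le_sqrt (by linarith [sq_nonneg ‖α t • (c - c')‖])
  have hs' : 0 < √(1 + m'.sqSum) := hs.trans_le hle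
  have h1 := G.logPartition_add_le (m.rate • m'.score) (m.rate • m.testScore α t s₁)
  have h2 := G.logPartition_add_le (m.rate • m.testScore α t s₁) (m.rate • m.score)
  rw [← hlead] at h1 h2
  rw [← hdist] at h2
  -- The passage to the smaller new rate, with θ the ratio of the new rate to the old one.
  have hres : m'.regretPotential ≤
      √(1 + m.sqSum) * (G.logPartition (m.rate • m'.score) - G.logPartition 0) := by
    have h := G.logPartition_smul_le (θ := √(1 + m.sqSum) / √(1 + m'.sqSum)) (by positivity)
      ((div_le_one hs').2 hle) (m.rate • m'.score)
    rw [smul_smul] at h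
    have hθ : √(1 + m.sqSum) / √(1 + m'.sqSum) * m.rate = m'.rate := by
      rw [rate, rate]; field_simp
    rw [hθ, div_mul_eq_mul_div, le_div_iff₀ hs'] at h
    rw [regretPotential]
    linarith
  set D := ∑ r, |G.logit (m.rate • m'.score) r - m.leadFlow α t s₁ r| with hD
  set y := m.leadFlow α t s₁ with hy
  set z' := G.logit (m.rate • m'.score) with hz'
  have e1 : ∑ r, z' r * ((m.rate • m.testScore α t s₁) r - (m.rate • m'.score) r) =
      m.rate * ∑ r, (α t • (c - c')) r * z' r := by
    rw [Finset.mul_sum]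
    refine Finset.sum_congr rfl fun r _ => ?_
    rw [htest, hscore]
    simp only [Pi.smul_apply, Pi.sub_apply, smul_eq_mul]
    ring
  have e2 : ∑ r, y r * ((m.rate • m.score) r - (m.rate • m.testScore α t s₁) r) =
      m.rate * (α t * ∑ r, c r * y r - ∑ r, (α t • (c - c')) r * y r) := by
    rw [Finset.mul_sum, ← Finset.sum_sub_distrib, Finset.mul_sum]
    refine Finset.sum_congr rfl fun r _ => ?_
    rw [htest]
    simp only [Pi.smul_apply, Pi.sub_apply, smul_eq_mul]
    ring
  rw [e1] at h1
  rw [e2] at h2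
  have hdual : -(‖α t • (c - c')‖ * D) ≤
      ∑ r, (α t • (c - c')) r * z' r - ∑ r, (α t • (c - c')) r * y r := by
    have h := abs_sum_mul_le (α t • (c - c')) fun r => z' r - y r
    simp only [mul_sub, Finset.sum_sub_distrib] at h
    exact (abs_le.1 h).1
  have hscal := mul_sub_sqrt_mul_sq_div_le (S := 1 + m.sqSum) (by linarith)
    (norm_nonneg (α t • (c - c'))) (G.sum_abs_sub_le_of_mem_feasible
      (G.logit_mem_feasible (m.rate • m'.score)) (m.leadFlow_mem_feasible α t s₁)) htot
  rw [add_assoc, ← hsq] at hscal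
  have h12 := mul_le_mul_of_nonneg_left (add_le_add h1 h2) hs.le
  have hexp : √(1 + m.sqSum) * m.rate * (∑ r, (α t • (c - c')) r * z' r +
      (α t * ∑ r, c r * y r - ∑ r, (α t • (c - c')) r * y r)) =
      ∑ r, (α t • (c - c')) r * z' r +
      (α t * ∑ r, c r * y r - ∑ r, (α t • (c - c')) r * y r) := by rw [hrate, one_mul]
  have hreg : m.regretPotential =
    √(1 + m.sqSum) * (G.logPartition (m.rate • m.score) - G.logPartition 0) := rfl
  rw [hreg]
  simp only [mul_add, mul_sub, mul_div_assoc'] at h12 hexp hres ⊢ hscal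
  linarith

theorem le_regretPotential [Nonempty I] (m : G.Memory) (hm : 0 ≤ m.sqSum) {f : G.Route → ℝ}
    (hf : f ∈ G.feasible) :
    ∑ r, m.score r * f r - √(1 + m.sqSum) * G.constC' ≤ m.regretPotential := by
  have hs : 0 < √(1 + m.sqSum) := Real.sqrt_pos.2 (by linarith)
  have h := mul_le_mul_of_nonneg_left (G.sum_mul_le_logPartition hf (m.rate • m.score)) hs.le
  have h0 := mul_le_mul_of_nonneg_left G.logPartition_zero_le_constC' hs.le
  have hrate : √(1 + m.sqSum) * m.rate = 1 := by rw [rate]; field_simp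
  have he : √(1 + m.sqSum) * ∑ r, (m.rate • m.score) r * f r = ∑ r, m.score r * f r := by
    rw [Finset.mul_sum]
    refine Finset.sum_congr rfl fun r _ => ?_
    rw [Pi.smul_apply, smul_eq_mul, ← mul_assoc, ← mul_assoc, hrate, one_mul]
  rw [he] at h
  rw [regretPotential, mul_sub]
  linarith

end Memory
end CongestionGame
end

/-! ### Convexity of the potential, averaging and the pathwise bound -/

noncomputable section

namespace CongestionGame

variable {V E I Ω : Type*} [Fintype I] [MeasurableSpace Ω] (G : CongestionGame V E I Ω)

instance : IsProbabilityMeasure G.law := G.isProbabilityMeasure_law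

theorem nodup_of_route (r : G.Route) : r.2.1.Nodup :=
  List.Nodup.of_map _ (G.isPath r.1 r.2.1 r.2.2).2.of_append_left

theorem load_mem_Icc {f : G.Route → ℝ} (hf : f ∈ G.feasible) (e : E) :
    G.load f e ∈ Set.Icc 0 (∑ i, G.demand i) := by
  constructor
  · exact Finset.sum_nonneg fun r _ => by split_ifs; exacts [hf.1 r, le_rfl]
  · change _ ≤ G.totalDemand
    rw [← G.sum_of_mem_feasible hf]
    exact Finset.sum_le_sum fun r _ => by split_ifs; exacts [le_rfl, hf.1 r]

open scoped Classical in
theorem load_sub (f g : G.Route → ℝ) (e : E) :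
    G.load g e - G.load f e = ∑ r : G.Route, if e ∈ r.2.1 then g r - f r else 0 := by
  rw [load, load, ← Finset.sum_sub_distrib]
  exact Finset.sum_congr rfl fun r _ => by split_ifs <;> simp

theorem integrable_cost (e : E) {x : ℝ} (hx : x ∈ Set.Icc 0 (∑ i, G.demand i)) :
    Integrable (G.cost e x) G.law := by
  obtain ⟨H, hH⟩ := G.cost_bounded
  refine Integrable.of_bound (G.cost_measurable e x hx).aestronglyMeasurable H
    (Filter.Eventually.of_forall fun s => ?_)
  rw [Real.norm_of_nonneg (G.cost_nonneg e s x hx)]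
  exact hH e s x hx

theorem monotoneOn_meanCost (e : E) :
    MonotoneOn (G.meanCost e) (Set.Icc 0 (∑ i, G.demand i)) := fun _ hx _ hy hxy =>
  integral_mono (G.integrable_cost e hx) (G.integrable_cost e hy) fun s =>
    G.cost_monotone e s hx hy hxy

section Potential

variable [Fintype E]

open scoped Classical in
theorem pathCost_eq_sum (f : G.Route → ℝ) (s : Ω) (r : G.Route) :
    G.pathCost f s r = ∑ e, if e ∈ r.2.1 then G.cost e (G.load f e) s else 0 := by
  rw [pathCost, ← List.sum_toFinset _ (G.nodup_of_route r), ← Finset.sum_filter]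
  exact Finset.sum_congr (by ext; simp) fun _ _ => rfl

open scoped Classical in
theorem meanPathCost_eq_sum {f : G.Route → ℝ} (hf : f ∈ G.feasible) (r : G.Route) :
    G.meanPathCost f r = ∑ e, if e ∈ r.2.1 then G.meanCost e (G.load f e) else 0 := by
  simp only [meanPathCost, pathCost_eq_sum]
  rw [integral_finsetSum]
  · refine Finset.sum_congr rfl fun e _ => ?_
    split_ifs
    · rfl
    · simp
  · intro e _
    split_ifs
    · exact G.integrable_cost e (G.load_mem_Icc hf e)
    · exact integrable_zero _ _ _

/-- Exchange of the sums over paths and edges. It relies on simple paths using each edge at most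
once. -/
theorem sum_meanPathCost_mul {f : G.Route → ℝ} (hf : f ∈ G.feasible) (g : G.Route → ℝ) :
    ∑ r, G.meanPathCost f r * (g r - f r) =
      ∑ e, G.meanCost e (G.load f e) * (G.load g e - G.load f e) := by
  classical
  simp only [G.meanPathCost_eq_sum hf, load_sub, Finset.sum_mul, Finset.mul_sum]
  rw [Finset.sum_comm]
  exact Finset.sum_congr rfl fun e _ => Finset.sum_congr rfl fun r _ => by split_ifs <;> simp

/-- The potential is convex: it lies above its linear approximations. -/
theorem potential_add_le {f g : G.Route → ℝ} (hf : f ∈ G.feasible) (hg : g ∈ G.feasible) :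
    G.potential f + ∑ r, G.meanPathCost f r * (g r - f r) ≤ G.potential g := by
  rw [G.sum_meanPathCost_mul hf, potential, potential, ← Finset.sum_add_distrib]
  refine Finset.sum_le_sum fun e _ => ?_
  have hx := G.load_mem_Icc hf e
  have hy := G.load_mem_Icc hg e
  have h0 : (0 : ℝ) ∈ Set.Icc 0 (∑ i, G.demand i) := ⟨le_rfl, hx.1.trans hx.2⟩
  have hint : ∀ {a b : ℝ}, a ∈ Set.Icc 0 (∑ i, G.demand i) → b ∈ Set.Icc 0 (∑ i, G.demand i) →
      IntervalIntegrable (G.meanCost e) volume a b := fun ha hb =>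
    ((G.monotoneOn_meanCost e).mono (Set.uIcc_subset_Icc ha hb)).intervalIntegrable
  rw [← intervalIntegral.integral_add_adjacent_intervals (hint h0 hx) (hint hx hy)]
  gcongr
  set x := G.load f e
  set y := G.load g e
  -- On either side of x the monotone mean cost dominates the rectangle of height c̄(x), with the
  -- sign reversed when y ≤ x; no differentiability is needed.
  rcases le_total x y with hxy | hxy
  · have h := intervalIntegral.integral_mono_on (μ := volume) (f := fun _ => G.meanCost e x) hxy
      intervalIntegrable_const (hint hx hy) fun u hu =>
        G.monotoneOn_meanCost e hx ⟨hx.1.trans hu.1, hu.2.trans hy.2⟩ hu.1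
    rw [intervalIntegral.integral_const, smul_eq_mul] at h
    linarith
  · have h := intervalIntegral.integral_mono_on (μ := volume) (g := fun _ => G.meanCost e x) hxy
      (hint hy hx) intervalIntegrable_const fun u hu =>
        G.monotoneOn_meanCost e ⟨hy.1.trans hu.1, hu.2.trans hx.2⟩ hx hu.2
    rw [intervalIntegral.integral_const, smul_eq_mul] at h
    rw [intervalIntegral.integral_symm]
    linarith

end Potential

/-- The step weights `αₜ = t`. -/
abbrev linearWeight : ℕ → ℝ := fun t => (t : ℝ)

theorem sum_range_linearWeight_pos (n : ℕ) :
    0 < ∑ s ∈ Finset.range (n + 2), linearWeight s := by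
  rw [Finset.sum_range_succ]
  have : 0 ≤ ∑ s ∈ Finset.range (n + 1), linearWeight s :=
    Finset.sum_nonneg fun s _ => Nat.cast_nonneg s
  have : (0 : ℝ) < ((n + 1 : ℕ) : ℝ) := by positivity
  linarith

theorem sum_range_linearWeight (n : ℕ) :
    ∑ s ∈ Finset.range (n + 1), linearWeight s = n * (n + 1) / 2 := by
  induction n with
  | zero => simp
  | succ n ih => rw [Finset.sum_range_succ, ih]; push_cast; ring

namespace Memory

variable {G}

/-- The memory `m` can be that of AdaWeight with step weights `t` after `n` epochs. -/
def IsValid (m : G.Memory) (n : ℕ) : Prop :=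
  0 ≤ m.sqSum ∧ ∃ x ∈ G.feasible,
    m.anchor = (∑ s ∈ Finset.range (n + 1), linearWeight s) • x

theorem IsValid.average_mem_feasible {m : G.Memory} {n : ℕ} (hm : m.IsValid n) {y : G.Route → ℝ}
    (hy : y ∈ G.feasible) : m.average linearWeight (n + 1) y ∈ G.feasible := by
  obtain ⟨-, x, hx, hanchor⟩ := hm
  have hW := sum_range_linearWeight_pos n
  have hW' : 0 ≤ ∑ s ∈ Finset.range (n + 1), linearWeight s :=
    Finset.sum_nonneg fun s _ => Nat.cast_nonneg s
  rw [average, hanchor, smul_add, smul_smul, smul_smul]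
  refine G.convex_feasible hy hx (by positivity) (by positivity) ?_
  rw [← mul_add, add_comm (linearWeight (n + 1)), ← Finset.sum_range_succ]
  exact inv_mul_cancel₀ hW.ne'

theorem IsValid.testFlow_mem_feasible {m : G.Memory} {n : ℕ} (hm : m.IsValid n) :
    m.testFlow linearWeight (n + 1) ∈ G.feasible :=
  hm.average_mem_feasible (G.logit_mem_feasible _)

theorem IsValid.recommendedFlow_mem_feasible {m : G.Memory} {n : ℕ} (hm : m.IsValid n) (s₁ : Ω) :
    m.recommendedFlow linearWeight (n + 1) s₁ ∈ G.feasible :=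
  hm.average_mem_feasible (G.logit_mem_feasible _)

theorem anchor_next_eq (m : G.Memory) (n : ℕ) (s₁ s₂ : Ω) :
    (m.next linearWeight (n + 1) s₁ s₂).anchor =
      (∑ s ∈ Finset.range (n + 2), linearWeight s) •
        m.recommendedFlow linearWeight (n + 1) s₁ := by
  rw [recommendedFlow, average, smul_smul,
    mul_inv_cancel₀ (sum_range_linearWeight_pos n).ne', one_smul]
  exact add_comm _ _

theorem IsValid.next {m : G.Memory} {n : ℕ} (hm : m.IsValid n) (s₁ s₂ : Ω) :
    (m.next linearWeight (n + 1) s₁ s₂).IsValid (n + 1) :=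
  ⟨add_nonneg hm.1 (sq_nonneg _), _, hm.recommendedFlow_mem_feasible s₁, m.anchor_next_eq n s₁ s₂⟩

/-- The two flows share the anchor, so only α_t/A_t = 2/(t + 1) of the difference of the leading
flows remains. This shrinkage is the source of the acceleration. -/
theorem sum_abs_recommendedFlow_sub_testFlow (m : G.Memory) (n : ℕ) (s₁ : Ω) :
    ∑ r, |m.recommendedFlow linearWeight (n + 1) s₁ r - m.testFlow linearWeight (n + 1) r| =
      2 / (n + 2) * m.leadDist linearWeight (n + 1) s₁ := by
  rw [leadDist, Finset.mul_sum]
  refine Finset.sum_congr rfl fun r _ => ?_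
  rw [recommendedFlow, testFlow, average, average]
  simp only [Pi.smul_apply, Pi.add_apply, smul_eq_mul]
  rw [← mul_sub, add_sub_add_right_eq_sub, ← mul_sub, abs_mul, abs_mul, ← mul_assoc]
  congr 1
  rw [sum_range_linearWeight, abs_of_nonneg (by positivity), abs_of_nonneg (by positivity)]
  push_cast
  field_simp
  ring

end Memory

theorem memory_isValid (s : ℕ → Phase → Ω) (n : ℕ) :
    (G.memory linearWeight s n).IsValid n := by
  induction n with
  -- The weight of index 0 is 0, so the initial anchor 0 is the zero multiple of any feasible flow.
  | zero => exact ⟨le_rfl, G.logit 0, G.logit_mem_feasible 0, by simp [memory]⟩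
  | succ n ih => exact ih.next _ _

/-- The recommended flow of epoch `k + 1`. -/
def recFlow (s : ℕ → Phase → Ω) (k : ℕ) : G.Route → ℝ :=
  (G.memory linearWeight s k).recommendedFlow linearWeight (k + 1) (s (k + 1) Phase.test)

/-- The test flow of epoch `k + 1`. -/
def tstFlow (s : ℕ → Phase → Ω) (k : ℕ) : G.Route → ℝ :=
  (G.memory linearWeight s k).testFlow linearWeight (k + 1)

/-- The leading flow of the recommendation phase of epoch `k + 1`. -/
def ldFlow (s : ℕ → Phase → Ω) (k : ℕ) : G.Route → ℝ :=
  (G.memory linearWeight s k).leadFlow linearWeight (k + 1) (s (k + 1) Phase.test)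

/-- The deviation of the path costs from their mean in epoch `k + 1`, in the recommendation
phase. -/
def recNoise (s : ℕ → Phase → Ω) (k : ℕ) : G.Route → ℝ :=
  G.pathCost (G.recFlow s k) (s (k + 1) Phase.recommend) - G.meanPathCost (G.recFlow s k)

/-- The deviation of the path costs from their mean in epoch `k + 1`, in the test phase. -/
def tstNoise (s : ℕ → Phase → Ω) (k : ℕ) : G.Route → ℝ :=
  G.pathCost (G.tstFlow s k) (s (k + 1) Phase.test) - G.meanPathCost (G.tstFlow s k)

theorem recFlow_mem_feasible (s : ℕ → Phase → Ω) (k : ℕ) : G.recFlow s k ∈ G.feasible :=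
  (G.memory_isValid s k).recommendedFlow_mem_feasible _

theorem tstFlow_mem_feasible (s : ℕ → Phase → Ω) (k : ℕ) : G.tstFlow s k ∈ G.feasible :=
  (G.memory_isValid s k).testFlow_mem_feasible

theorem ldFlow_mem_feasible (s : ℕ → Phase → Ω) (k : ℕ) : G.ldFlow s k ∈ G.feasible :=
  G.logit_mem_feasible _

theorem sum_weight_smul_recFlow (s : ℕ → Phase → Ω) (k : ℕ) :
    (∑ j ∈ Finset.range (k + 2), linearWeight j) • G.recFlow s k =
      ((k + 1 : ℕ) : ℝ) • G.ldFlow s k + (G.memory linearWeight s k).anchor := by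
  rw [recFlow, ← Memory.anchor_next_eq _ _ _ (s (k + 1) Phase.recommend)]
  exact add_comm _ _

/-- The regret with respect to the mean costs controls the gap of the recommended flow. -/
theorem weight_mul_potential_sub_le [Fintype E] (s : ℕ → Phase → Ω) {f : G.Route → ℝ} (hf : f ∈ G.feasible)
    (n : ℕ) :
    (∑ j ∈ Finset.range (n + 2), linearWeight j) *
        (G.potential (G.recFlow s n) - G.potential f) ≤
      ∑ k ∈ Finset.range (n + 1), ((k + 1 : ℕ) : ℝ) *
        ∑ r, G.meanPathCost (G.recFlow s k) r * (G.ldFlow s k r - f r) := by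
  -- Convexity at x^t is used against the previous average with weight A_{t-1} and against f with
  -- weight α_t. Since A_t x^t = A_{t-1} x^{t-1} + α_t y^t, the linear terms collapse to -α_t
  -- ⟨c̄(x^t), y^t - f⟩.
  have hstep : ∀ n (x : G.Route → ℝ), x ∈ G.feasible → (G.memory linearWeight s n).anchor =
      (∑ j ∈ Finset.range (n + 1), linearWeight j) • x →
      (∑ j ∈ Finset.range (n + 2), linearWeight j) *
        (G.potential (G.recFlow s n) - G.potential f) ≤
      (∑ j ∈ Finset.range (n + 1), linearWeight j) * (G.potential x - G.potential f) +
        ((n + 1 : ℕ) : ℝ) *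
          ∑ r, G.meanPathCost (G.recFlow s n) r * (G.ldFlow s n r - f r) := by
    intro n x hx hanchor
    have hW : 0 ≤ ∑ j ∈ Finset.range (n + 1), linearWeight j :=
      Finset.sum_nonneg fun s _ => Nat.cast_nonneg s
    have h1 := mul_le_mul_of_nonneg_left (G.potential_add_le (G.recFlow_mem_feasible s n) hx) hW
    have h2 := mul_le_mul_of_nonneg_left (G.potential_add_le (G.recFlow_mem_feasible s n) hf)
      (Nat.cast_nonneg (α := ℝ) (n + 1))
    have hsum : ∑ j ∈ Finset.range (n + 2), linearWeight j =
      ∑ j ∈ Finset.range (n + 1), linearWeight j + ((n + 1 : ℕ) : ℝ) := Finset.sum_range_succ _ _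
    have hvec := G.sum_weight_smul_recFlow s n
    rw [hanchor, hsum] at hvec
    rw [hsum]
    set W := ∑ j ∈ Finset.range (n + 1), linearWeight j
    have hlin : W * ∑ r, G.meanPathCost (G.recFlow s n) r * (x r - G.recFlow s n r) +
        ((n + 1 : ℕ) : ℝ) * ∑ r, G.meanPathCost (G.recFlow s n) r * (f r - G.recFlow s n r) =
        -(((n + 1 : ℕ) : ℝ) *
          ∑ r, G.meanPathCost (G.recFlow s n) r * (G.ldFlow s n r - f r)) := by
      rw [Finset.mul_sum, Finset.mul_sum, Finset.mul_sum, ← Finset.sum_add_distrib,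
        ← Finset.sum_neg_distrib]
      refine Finset.sum_congr rfl fun r _ => ?_
      have := congrFun hvec r
      simp only [Pi.smul_apply, Pi.add_apply, smul_eq_mul] at this
      linear_combination -(G.meanPathCost (G.recFlow s n) r) * this
    linarith
  induction n with
  | zero =>
    have h := hstep 0 (G.logit 0) (G.logit_mem_feasible 0) (by simp [memory])
    simpa using h
  | succ n ih =>
    have h := hstep (n + 1) (G.recFlow s n) (G.recFlow_mem_feasible s n)
      (Memory.anchor_next_eq _ _ _ _)
    rw [Finset.sum_range_succ _ (n + 1)]
    linarith

theorem sqSum_memory (s : ℕ → Phase → Ω) (n : ℕ) :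
    (G.memory linearWeight s n).sqSum = ∑ k ∈ Finset.range n,
      ‖((k + 1 : ℕ) : ℝ) • (G.pathCost (G.recFlow s k) (s (k + 1) Phase.recommend) -
        G.pathCost (G.tstFlow s k) (s (k + 1) Phase.test))‖ ^ 2 := by
  induction n with
  | zero => rfl
  | succ n ih => rw [Finset.sum_range_succ, ← ih]; rfl

theorem score_memory (s : ℕ → Phase → Ω) (n : ℕ) (r : G.Route) :
    (G.memory linearWeight s n).score r = -∑ k ∈ Finset.range n, ((k + 1 : ℕ) : ℝ) *
      G.pathCost (G.recFlow s k) (s (k + 1) Phase.recommend) r := by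
  induction n with
  | zero => simp [memory]
  | succ n ih =>
    rw [Finset.sum_range_succ, neg_add, ← ih]
    exact sub_eq_add_neg _ _

theorem regretPotential_memory_le [Nonempty I] (s : ℕ → Phase → Ω) (n : ℕ) :
    (G.memory linearWeight s n).regretPotential +
      ∑ k ∈ Finset.range n, ((k + 1 : ℕ) : ℝ) *
        ∑ r, G.pathCost (G.recFlow s k) (s (k + 1) Phase.recommend) r * G.ldFlow s k r +
      ∑ k ∈ Finset.range n, √(1 + (G.memory linearWeight s k).sqSum) *
        (G.memory linearWeight s k).leadDist linearWeight (k + 1) (s (k + 1) Phase.test) ^ 2 /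
          (4 * G.totalDemand) ≤
    4 * G.totalDemand * (√(1 + (G.memory linearWeight s n).sqSum) - 1) := by
  induction n with
  | zero => simp [memory, Memory.regretPotential]
  | succ n ih =>
    rw [Finset.sum_range_succ, Finset.sum_range_succ]
    have h := (G.memory linearWeight s n).regretPotential_next_le (G.memory_isValid s n).1
      linearWeight (n + 1) (s (n + 1) Phase.test) (s (n + 1) Phase.recommend)
    change (G.memory linearWeight s (n + 1)).regretPotential + ((n + 1 : ℕ) : ℝ) *
      ∑ r, G.pathCost (G.recFlow s n) (s (n + 1) Phase.recommend) r * G.ldFlow s n r + _ ≤ _ +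
      4 * G.totalDemand * (√(1 + (G.memory linearWeight s (n + 1)).sqSum) - _) at h
    linarith

/-- The comparator costs C'√S and the telescoped growth 4‖m‖₁(√S - 1), where S is one plus the
accumulated square sum. With C' split off, the factor of √S - 1 is C' + 4‖m‖₁ ≤ C/2. -/
theorem regret_le [Nonempty I] (s : ℕ → Phase → Ω) {f : G.Route → ℝ} (hf : f ∈ G.feasible)
    (n : ℕ) :
    ∑ k ∈ Finset.range n, ((k + 1 : ℕ) : ℝ) *
      ∑ r, G.pathCost (G.recFlow s k) (s (k + 1) Phase.recommend) r *
        (G.ldFlow s k r - f r) ≤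
    G.constC' + (G.constC / 2 * (√(1 + (G.memory linearWeight s n).sqSum) - 1) -
      ∑ k ∈ Finset.range n, √(1 + (G.memory linearWeight s k).sqSum) *
        (G.memory linearWeight s k).leadDist linearWeight (k + 1) (s (k + 1) Phase.test) ^ 2 /
          (4 * G.totalDemand)) := by
  have h1 := G.regretPotential_memory_le s n
  have h2 := (G.memory linearWeight s n).le_regretPotential (G.memory_isValid s n).1 hf
  have hscore : ∑ r, (G.memory linearWeight s n).score r * f r =
      -∑ k ∈ Finset.range n, ((k + 1 : ℕ) : ℝ) *
        ∑ r, G.pathCost (G.recFlow s k) (s (k + 1) Phase.recommend) r * f r := by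
    simp only [score_memory, neg_mul, Finset.sum_neg_distrib, Finset.sum_mul, Finset.mul_sum]
    rw [Finset.sum_comm]
    simp only [mul_assoc]
  have hs : 1 ≤ √(1 + (G.memory linearWeight s n).sqSum) :=
    Real.one_le_sqrt.2 (by linarith [(G.memory_isValid s n).1])
  have hC := G.two_mul_constC'_add_le
  have hm := G.totalDemand_pos
  simp only [mul_sub, Finset.sum_sub_distrib] at *
  nlinarith [mul_nonneg (sub_nonneg.2 hs)
    (by linarith : 0 ≤ G.constC / 2 - G.constC' - 4 * G.totalDemand)]

/-- Smoothness controls the difference of the mean costs, and α_t · α_t/A_t ≤ 2 removes the growth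
of the weights. The noises of the two phases are merged into one root to fit `half_mul_sqrt_sub_le`.
-/
theorem norm_cost_sub_le {L : ℝ} (hL : 0 ≤ L) (hG : G.IsSmoothWith L) (s : ℕ → Phase → Ω)
    (k : ℕ) :
    ‖((k + 1 : ℕ) : ℝ) • (G.pathCost (G.recFlow s k) (s (k + 1) Phase.recommend) -
        G.pathCost (G.tstFlow s k) (s (k + 1) Phase.test))‖ ≤
      2 * L * (G.memory linearWeight s k).leadDist linearWeight (k + 1) (s (k + 1) Phase.test) +
        √(2 * ((k + 1 : ℕ) : ℝ) ^ 2 * (‖G.recNoise s k‖ ^ 2 + ‖G.tstNoise s k‖ ^ 2)) := by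
  set D := (G.memory linearWeight s k).leadDist linearWeight (k + 1) (s (k + 1) Phase.test) with hD
  have hD0 : 0 ≤ D := Memory.leadDist_nonneg _ _ _ _
  have hsm := hG _ (G.recFlow_mem_feasible s k) _ (G.tstFlow_mem_feasible s k)
  have hdist : ∑ r, |G.recFlow s k r - G.tstFlow s k r| = 2 / (k + 2) * D :=
    Memory.sum_abs_recommendedFlow_sub_testFlow _ _ _
  rw [hdist] at hsm
  have hdec : G.pathCost (G.recFlow s k) (s (k + 1) Phase.recommend) -
      G.pathCost (G.tstFlow s k) (s (k + 1) Phase.test) =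
      (G.meanPathCost (G.recFlow s k) - G.meanPathCost (G.tstFlow s k)) +
        (G.recNoise s k - G.tstNoise s k) := by
    rw [recNoise, tstNoise]; abel
  have hw : (0 : ℝ) ≤ ((k + 1 : ℕ) : ℝ) := Nat.cast_nonneg _
  rw [hdec, norm_smul, Real.norm_of_nonneg hw]
  have h1 : ((k + 1 : ℕ) : ℝ) * (L * (2 / (k + 2) * D)) ≤ 2 * L * D := by
    have : ((k + 1 : ℕ) : ℝ) * (2 / (k + 2)) ≤ 2 := by
      rw [mul_div_assoc', div_le_iff₀ (by positivity)]
      push_cast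
      linarith
    nlinarith [mul_le_mul_of_nonneg_right this (mul_nonneg hL hD0)]
  have h2 : ((k + 1 : ℕ) : ℝ) * (‖G.recNoise s k‖ + ‖G.tstNoise s k‖) ≤
      √(2 * ((k + 1 : ℕ) : ℝ) ^ 2 * (‖G.recNoise s k‖ ^ 2 + ‖G.tstNoise s k‖ ^ 2)) := by
    refine Real.le_sqrt_of_sq_le ?_
    rw [mul_pow, mul_comm (2 : ℝ), mul_assoc]
    gcongr
    nlinarith [sq_nonneg (‖G.recNoise s k‖ - ‖G.tstNoise s k‖)]
  calc ((k + 1 : ℕ) : ℝ) * ‖(G.meanPathCost (G.recFlow s k) - G.meanPathCost (G.tstFlow s k)) +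
        (G.recNoise s k - G.tstNoise s k)‖
      ≤ ((k + 1 : ℕ) : ℝ) * (L * (2 / (k + 2) * D) + (‖G.recNoise s k‖ + ‖G.tstNoise s k‖)) := by
        refine mul_le_mul_of_nonneg_left ?_ hw
        exact (norm_add_le _ _).trans (add_le_add hsm (norm_sub_le _ _))
    _ ≤ _ := by rw [mul_add]; exact add_le_add h1 h2

/-- The accumulated squared noise of the epochs `1, …, n`. -/
def noiseSum (s : ℕ → Phase → Ω) (n : ℕ) : ℝ :=
  ∑ k ∈ Finset.range n, ((k + 1 : ℕ) : ℝ) ^ 2 * (‖G.recNoise s k‖ ^ 2 + ‖G.tstNoise s k‖ ^ 2)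

/-- The martingale part of the regret. -/
def noiseRegret (s : ℕ → Phase → Ω) (f : G.Route → ℝ) (n : ℕ) : ℝ :=
  ∑ k ∈ Finset.range n, ((k + 1 : ℕ) : ℝ) *
    ∑ r, G.recNoise s k r * (G.ldFlow s k r - f r)

/-- The pathwise guarantee of AdaWeight. -/
theorem weight_mul_potential_sub_add_noiseRegret_le [Fintype E] [Nonempty I] {L : ℝ} (hL : 0 ≤ L)
    (hG : G.IsSmoothWith L) (s : ℕ → Phase → Ω) {f : G.Route → ℝ} (hf : f ∈ G.feasible) (n : ℕ) :
    (∑ j ∈ Finset.range (n + 2), linearWeight j) *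
        (G.potential (G.recFlow s n) - G.potential f) + G.noiseRegret s f (n + 1) ≤
      G.constC' + (G.constC / 2 * √(4 * G.noiseSum s (n + 1)) +
        8 * L * √(Fintype.card I * G.maxDemand) * G.constC ^ (3 / 2 : ℝ)) := by
  have h1 := G.weight_mul_potential_sub_le s hf n
  have h2 := G.regret_le s hf (n + 1)
  have h3 := half_mul_sqrt_sub_le hL G.totalDemand_pos G.totalDemand_le
    G.card_mul_maxDemand_le_constC
    (a := fun k => ‖((k + 1 : ℕ) : ℝ) • (G.pathCost (G.recFlow s k) (s (k + 1) Phase.recommend) -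
        G.pathCost (G.tstFlow s k) (s (k + 1) Phase.test))‖)
    (d := fun k => (G.memory linearWeight s k).leadDist linearWeight (k + 1)
      (s (k + 1) Phase.test))
    (ν := fun k =>
      √(2 * ((k + 1 : ℕ) : ℝ) ^ 2 * (‖G.recNoise s k‖ ^ 2 + ‖G.tstNoise s k‖ ^ 2)))
    (fun _ => norm_nonneg _) (fun _ => Memory.leadDist_nonneg _ _ _ _)
    (fun _ => Memory.leadDist_le _ _ _ _)
    (G.norm_cost_sub_le hL hG s) (n + 1)
  simp only [← sqSum_memory] at h3
  have hν : 2 * ∑ k ∈ Finset.range (n + 1),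
      √(2 * ((k + 1 : ℕ) : ℝ) ^ 2 * (‖G.recNoise s k‖ ^ 2 + ‖G.tstNoise s k‖ ^ 2)) ^ 2 =
      4 * G.noiseSum s (n + 1) := by
    rw [noiseSum, Finset.mul_sum, Finset.mul_sum]
    refine Finset.sum_congr rfl fun k _ => ?_
    rw [Real.sq_sqrt (by positivity)]
    ring
  rw [hν] at h3
  have hsplit : ∑ k ∈ Finset.range (n + 1), ((k + 1 : ℕ) : ℝ) *
        ∑ r, G.meanPathCost (G.recFlow s k) r * (G.ldFlow s k r - f r) +
      G.noiseRegret s f (n + 1) =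
      ∑ k ∈ Finset.range (n + 1), ((k + 1 : ℕ) : ℝ) *
      ∑ r, G.pathCost (G.recFlow s k) (s (k + 1) Phase.recommend) r *
        (G.ldFlow s k r - f r) := by
    rw [noiseRegret, ← Finset.sum_add_distrib]
    refine Finset.sum_congr rfl fun k _ => ?_
    rw [← mul_add, ← Finset.sum_add_distrib]
    refine congrArg _ (Finset.sum_congr rfl fun r _ => ?_)
    rw [recNoise, Pi.sub_apply]
    ring
  linarith

end CongestionGame
end

/-! ### Probabilistic tools and measurability of the algorithm -/

noncomputable section

/-- Integrating out a random variable that is independent of the remaining randomness. -/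
theorem integral_comp_prodMk_of_indepFun {Ξ S Ω : Type*} {mΞ : MeasurableSpace Ξ}
    [MeasurableSpace S] [MeasurableSpace Ω] {μ : Measure Ξ} [IsProbabilityMeasure μ]
    {ν : Measure Ω} [IsProbabilityMeasure ν] {X : Ξ → S} {W : Ξ → Ω} (hX : Measurable X)
    (hW : Measurable W) (hν : μ.map W = ν) (hind : IndepFun X W μ) {g : S × Ω → ℝ}
    (hg : Measurable g) {B : ℝ} (hB : ∀ p, |g p| ≤ B) :
    ∫ ξ, g (X ξ, W ξ) ∂μ = ∫ ξ, ∫ w, g (X ξ, w) ∂ν ∂μ := by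
  have := Measure.isProbabilityMeasure_map (μ := μ) hX.aemeasurable
  have hmap := (indepFun_iff_map_prod_eq_prod_map_map hX.aemeasurable hW.aemeasurable).1 hind
  rw [hν] at hmap
  have hint : Integrable g ((μ.map X).prod ν) :=
    Integrable.of_bound hg.aestronglyMeasurable B (Filter.Eventually.of_forall hB)
  calc ∫ ξ, g (X ξ, W ξ) ∂μ = ∫ p, g p ∂(μ.map fun ξ => (X ξ, W ξ)) :=
        (integral_map (hX.prodMk hW).aemeasurable hg.aestronglyMeasurable).symm
    _ = ∫ x, ∫ w, g (x, w) ∂ν ∂(μ.map X) := by rw [hmap, integral_prod _ hint]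
    _ = ∫ ξ, ∫ w, g (X ξ, w) ∂ν ∂μ :=
        integral_map hX.aemeasurable
          (hg.stronglyMeasurable.integral_prod_right' (ν := ν)).aestronglyMeasurable

/-- A random variable that is a function of some members of an independent family is independent
of the other members. -/
theorem indepFun_of_measurable_iSup_comap {Ξ S Ω ι : Type*} {mΞ : MeasurableSpace Ξ}
    [MeasurableSpace S] [mΩ : MeasurableSpace Ω] {μ : Measure Ξ} {ω : ι → Ξ → Ω}
    (hω : ∀ j, Measurable (ω j)) (hind : iIndepFun ω μ) {J : Set ι} {j : ι} (hj : j ∉ J)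
    {X : Ξ → S} (hX : Measurable[⨆ i ∈ J, mΩ.comap (ω i)] X) : IndepFun X (ω j) μ := by
  rw [IndepFun_iff_Indep]
  have h := indep_iSup_of_disjoint (fun i => (hω i).comap_le) hind.iIndep
    (Set.disjoint_singleton_right.2 hj)
  rw [iSup_singleton] at h
  exact indep_of_indep_of_le_left h hX.comap_le

/-- Jensen's inequality for the square root. -/
theorem integral_sqrt_le_sqrt_integral {Ξ : Type*} {mΞ : MeasurableSpace Ξ} {μ : Measure Ξ}
    [IsProbabilityMeasure μ] {X : Ξ → ℝ} (hX : Integrable X μ) (h0 : ∀ ξ, 0 ≤ X ξ) :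
    Integrable (fun ξ => √(X ξ)) μ ∧ ∫ ξ, √(X ξ) ∂μ ≤ √(∫ ξ, X ξ ∂μ) := by
  have hint : Integrable (fun ξ => √(X ξ)) μ := by
    refine Integrable.mono' (hX.add (integrable_const 1))
      (Real.continuous_sqrt.comp_aestronglyMeasurable hX.aestronglyMeasurable)
      (Filter.Eventually.of_forall fun ξ => ?_)
    rw [Real.norm_of_nonneg (Real.sqrt_nonneg _)]
    refine Real.sqrt_le_iff.2 ⟨add_nonneg (h0 ξ) zero_le_one, ?_⟩
    simp only [Pi.add_apply]
    nlinarith [h0 ξ]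
  exact ⟨hint, Real.strictConcaveOn_sqrt.concaveOn.le_map_integral
    Real.continuous_sqrt.continuousOn isClosed_Ici (Filter.Eventually.of_forall h0) hX hint⟩

namespace CongestionGame

variable {V E I Ω : Type*} [Fintype I] [MeasurableSpace Ω] (G : CongestionGame V E I Ω)

theorem continuous_load (e : E) : Continuous fun f : G.Route → ℝ => G.load f e := by
  unfold load
  refine continuous_finsetSum _ fun r _ => ?_
  split_ifs
  · exact continuous_apply r
  · exact continuous_const

theorem continuous_logit : Continuous G.logit := by
  refine continuous_pi fun r => ?_
  refine Continuous.div (by fun_prop) (by fun_prop) fun Y => (G.sum_exp_pos Y r.1).ne'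

/-- The projection of a real number to the interval of possible loads. -/
def clamp (x : ℝ) : ℝ := max 0 (min (∑ i, G.demand i) x)

theorem clamp_mem (x : ℝ) : G.clamp x ∈ Set.Icc 0 (∑ i, G.demand i) :=
  ⟨le_max_left _ _, max_le G.totalDemand_nonneg (min_le_left _ _)⟩

theorem clamp_of_mem {x : ℝ} (hx : x ∈ Set.Icc 0 (∑ i, G.demand i)) : G.clamp x = x := by
  rw [clamp, min_eq_right hx.2, max_eq_right hx.1]

theorem continuous_clamp : Continuous G.clamp := by
  unfold clamp; fun_prop

theorem monotone_clamp : Monotone G.clamp := fun _ _ h => max_le_max_left _ (min_le_min_left _ h)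

/-- A Carathéodory function, continuous in the load and measurable in the state, is jointly
measurable. The clamp is needed because regularity of the costs is known only on the interval of
possible loads. -/
theorem measurable_cost_clamp (e : E) :
    Measurable fun p : ℝ × Ω => G.cost e (G.clamp p.1) p.2 := by
  obtain ⟨K, hK⟩ := G.cost_lipschitz
  exact measurable_uncurry_of_continuous_of_measurable (u := fun x s => G.cost e (G.clamp x) s)
    (fun s => (hK e s).continuousOn.comp_continuous G.continuous_clamp G.clamp_mem)
    (fun x => G.cost_measurable e _ (G.clamp_mem x))

theorem isCompact_feasible : IsCompact G.feasible := by
  refine Metric.isCompact_of_isClosed_isBounded ?_ ?_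
  · refine IsClosed.inter (isClosed_le continuous_const continuous_id : IsClosed {f : G.Route → ℝ |
      (0 : G.Route → ℝ) ≤ f}) ?_
    have h : {f : G.Route → ℝ | ∀ i, ∑ p : {p : List E // p ∈ G.paths i}, f ⟨i, p⟩ = G.demand i} =
        ⋂ i, {f | ∑ p : {p : List E // p ∈ G.paths i}, f ⟨i, p⟩ = G.demand i} := by
      ext f; simp
    change IsClosed {f : G.Route → ℝ |
      ∀ i, ∑ p : {p : List E // p ∈ G.paths i}, f ⟨i, p⟩ = G.demand i}
    rw [h]
    exact isClosed_iInter fun i => isClosed_eq (by fun_prop) continuous_const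
  · refine (Metric.isBounded_closedBall (x := (0 : G.Route → ℝ)) (r := G.totalDemand)).subset
      fun f hf => ?_
    rw [mem_closedBall_zero_iff, pi_norm_le_iff_of_nonneg G.totalDemand_nonneg]
    intro r
    rw [Real.norm_of_nonneg (hf.1 r), ← G.sum_of_mem_feasible hf]
    exact Finset.single_le_sum (fun r _ => hf.1 r) (Finset.mem_univ r)

section Measurability

variable {Ξ : Type*} {mΞ : MeasurableSpace Ξ}

/-- The components of a random memory are measurable. -/
structure MeasurableMemory {Ξ : Type*} [MeasurableSpace Ξ] (m : Ξ → G.Memory) : Prop where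
  anchor : Measurable fun ξ => (m ξ).anchor
  score : Measurable fun ξ => (m ξ).score
  sqSum : Measurable fun ξ => (m ξ).sqSum

namespace MeasurableMemory

variable {G}

theorem average {m : Ξ → G.Memory} (hm : G.MeasurableMemory m) {y : Ξ → G.Route → ℝ}
    (hy : Measurable y) (α : ℕ → ℝ) (t : ℕ) :
    Measurable fun ξ => (m ξ).average α t (y ξ) := by
  have ha := hm.anchor
  unfold Memory.average
  fun_prop

theorem logit {m : Ξ → G.Memory} (hm : G.MeasurableMemory m) {Y : Ξ → G.Route → ℝ}
    (hY : Measurable Y) : Measurable fun ξ => G.logit ((m ξ).rate • Y ξ) := by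
  have hq := hm.sqSum
  have hr : Measurable fun ξ => (m ξ).rate := by
    unfold Memory.rate
    fun_prop
  have h : Measurable fun ξ => (m ξ).rate • Y ξ := by fun_prop
  exact G.continuous_logit.measurable.comp h

theorem testFlow {m : Ξ → G.Memory} (hm : G.MeasurableMemory m) (α : ℕ → ℝ) (t : ℕ) :
    Measurable fun ξ => (m ξ).testFlow α t :=
  hm.average (hm.logit hm.score) α t

end MeasurableMemory

end Measurability

/-! ### Everywhere defined versions of costs, noise and potential -/

variable [Fintype E]

open scoped Classical in
/-- The path costs, with loads projected to the interval of possible loads. -/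
def clampCost (f : G.Route → ℝ) (s : Ω) : G.Route → ℝ :=
  fun r => ∑ e, if e ∈ r.2.1 then G.cost e (G.clamp (G.load f e)) s else 0

theorem clampCost_eq {f : G.Route → ℝ} (hf : f ∈ G.feasible) (s : Ω) :
    G.clampCost f s = G.pathCost f s := by
  funext r
  rw [pathCost_eq_sum, clampCost]
  simp only [G.clamp_of_mem (G.load_mem_Icc hf _)]

theorem measurable_clampCost :
    Measurable fun p : (G.Route → ℝ) × Ω => G.clampCost p.1 p.2 := by
  refine measurable_pi_lambda _ fun r => ?_
  refine Finset.measurable_sum _ fun e _ => ?_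
  split_ifs
  · exact (G.measurable_cost_clamp e).comp
      (((G.continuous_load e).measurable.comp measurable_fst).prodMk measurable_snd)
  · exact measurable_const

theorem exists_norm_clampCost_le : ∃ B : ℝ, 0 ≤ B ∧ ∀ f s, ‖G.clampCost f s‖ ≤ B := by
  obtain ⟨H, hH⟩ := G.cost_bounded
  refine ⟨∑ _e : E, |H|, by positivity, fun f s => ?_⟩
  rw [pi_norm_le_iff_of_nonneg (by positivity)]
  refine fun r => (norm_sum_le _ _).trans (Finset.sum_le_sum fun e _ => ?_)
  split_ifs
  · rw [Real.norm_of_nonneg (G.cost_nonneg e s _ (G.clamp_mem _))]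
    exact (hH e s _ (G.clamp_mem _)).trans (le_abs_self H)
  · simp

theorem integrable_clampCost (f : G.Route → ℝ) (r : G.Route) :
    Integrable (fun s => G.clampCost f s r) G.law := by
  obtain ⟨B, -, hB⟩ := G.exists_norm_clampCost_le
  exact Integrable.of_bound ((measurable_pi_apply r).comp
    (G.measurable_clampCost.comp measurable_prodMk_left)).aestronglyMeasurable B
    (Filter.Eventually.of_forall fun s => (norm_le_pi_norm _ r).trans (hB f s))

/-- The deviation of the path costs from their mean, with loads projected to the interval of
possible loads. -/
def clampNoise (f : G.Route → ℝ) (s : Ω) : G.Route → ℝ :=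
  fun r => G.clampCost f s r - ∫ s', G.clampCost f s' r ∂G.law

theorem clampNoise_eq {f : G.Route → ℝ} (hf : f ∈ G.feasible) (s : Ω) :
    G.clampNoise f s = G.pathCost f s - G.meanPathCost f := by
  funext r
  simp only [clampNoise, meanPathCost, G.clampCost_eq hf, Pi.sub_apply]

theorem measurable_clampNoise :
    Measurable fun p : (G.Route → ℝ) × Ω => G.clampNoise p.1 p.2 := by
  refine measurable_pi_lambda _ fun r => ?_
  have h : Measurable fun p : (G.Route → ℝ) × Ω => G.clampCost p.1 p.2 r :=
    (measurable_pi_apply r).comp G.measurable_clampCost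
  exact h.sub ((h.stronglyMeasurable.integral_prod_right' (ν := G.law)).measurable.comp
    measurable_fst)

theorem exists_norm_clampNoise_le : ∃ B : ℝ, 0 ≤ B ∧ ∀ f s, ‖G.clampNoise f s‖ ≤ B := by
  obtain ⟨B, hB0, hB⟩ := G.exists_norm_clampCost_le
  refine ⟨B + B, by positivity, fun f s => ?_⟩
  rw [pi_norm_le_iff_of_nonneg (by positivity)]
  refine fun r => (norm_sub_le _ _).trans (add_le_add ((norm_le_pi_norm _ r).trans (hB f s)) ?_)
  have h := norm_integral_le_of_norm_le_const (μ := G.law)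
    (Filter.Eventually.of_forall fun s => (norm_le_pi_norm _ r).trans (hB f s))
  rwa [probReal_univ, mul_one] at h

theorem integral_clampNoise (f : G.Route → ℝ) (r : G.Route) :
    ∫ s, G.clampNoise f s r ∂G.law = 0 := by
  simp only [clampNoise]
  rw [integral_sub (G.integrable_clampCost f r) (integrable_const _), integral_const,
    probReal_univ, one_smul, sub_self]

theorem variance_le_noiseLevel_sq {f : G.Route → ℝ} (hf : f ∈ G.feasible) :
    ∫ s, ‖G.clampNoise f s‖ ^ 2 ∂G.law ≤ G.noiseLevel ^ 2 := by
  obtain ⟨B, hB0, hB⟩ := G.exists_norm_clampNoise_le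
  -- Needed because a real `iSup` over an unbounded family takes the default value 0.
  have hbdd : BddAbove (Set.range fun f : G.feasible =>
      ∫ s, ‖G.pathCost f s - G.meanPathCost f‖ ^ 2 ∂G.law) := by
    refine ⟨B ^ 2, ?_⟩
    rintro _ ⟨f, rfl⟩
    simp only [← G.clampNoise_eq f.2]
    have h := norm_integral_le_of_norm_le_const (μ := G.law)
      (f := fun s => ‖G.clampNoise f s‖ ^ 2) (C := B ^ 2)
      (Filter.Eventually.of_forall fun s => by
        rw [Real.norm_of_nonneg (sq_nonneg _)]
        exact pow_le_pow_left₀ (norm_nonneg _) (hB _ _) 2)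
    rw [probReal_univ, mul_one] at h
    exact (le_abs_self _).trans h
  rw [noiseLevel, Real.sq_sqrt (Real.iSup_nonneg fun f => integral_nonneg fun s => sq_nonneg _)]
  simp only [G.clampNoise_eq hf]
  exact le_ciSup hbdd ⟨f, hf⟩

/-- The potential agrees on feasible flows with a continuous function. -/
theorem exists_continuous_potential_eq :
    ∃ Φ : (G.Route → ℝ) → ℝ, Continuous Φ ∧ ∀ f ∈ G.feasible, G.potential f = Φ f := by
  -- Clamping makes the mean cost monotone on the whole line, hence interval integrable, so its
  -- primitive is continuous.
  have hmono : ∀ e, Monotone fun x => G.meanCost e (G.clamp x) := fun e x y h =>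
    G.monotoneOn_meanCost e (G.clamp_mem x) (G.clamp_mem y) (G.monotone_clamp h)
  refine ⟨fun f => ∑ e, ∫ u in (0 : ℝ)..G.load f e, G.meanCost e (G.clamp u), ?_, fun f hf => ?_⟩
  · exact continuous_finsetSum _ fun e _ =>
      (intervalIntegral.continuous_primitive
        (fun a b => (hmono e).intervalIntegrable) 0).comp (G.continuous_load e)
  · refine Finset.sum_congr rfl fun e _ => intervalIntegral.integral_congr fun u hu => ?_
    have hx := G.load_mem_Icc hf e
    rw [Set.uIcc_of_le hx.1] at hu
    simp only [G.clamp_of_mem ⟨hu.1, hu.2.trans hx.2⟩]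

theorem exists_abs_potential_le : ∃ B : ℝ, ∀ f ∈ G.feasible, |G.potential f| ≤ B := by
  obtain ⟨Φ, hΦ, heq⟩ := G.exists_continuous_potential_eq
  obtain ⟨B, hB⟩ := G.isCompact_feasible.exists_bound_of_continuousOn hΦ.continuousOn
  exact ⟨B, fun f hf => by rw [heq f hf]; exact hB f hf⟩

theorem gap_le_of_forall {f : G.Route → ℝ} {B : ℝ}
    (h : ∀ g ∈ G.feasible, G.potential f - G.potential g ≤ B) : G.gap f ≤ B := by
  have : G.potential f - B ≤ sInf (G.potential '' G.feasible) := by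
    refine le_csInf ⟨_, _, G.logit_mem_feasible 0, rfl⟩ ?_
    rintro _ ⟨g, hg, rfl⟩
    linarith [h g hg]
  rw [gap]
  linarith

section Measurability

variable {Ξ : Type*} {mΞ : MeasurableSpace Ξ}

namespace MeasurableMemory

variable {G}

theorem pathCost {f : Ξ → G.Route → ℝ} (hf : Measurable f) (hff : ∀ ξ, f ξ ∈ G.feasible)
    {s : Ξ → Ω} (hs : Measurable s) : Measurable fun ξ => G.pathCost (f ξ) (s ξ) := by
  have h : (fun ξ => G.pathCost (f ξ) (s ξ)) = fun ξ => G.clampCost (f ξ) (s ξ) :=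
    funext fun ξ => (G.clampCost_eq (hff ξ) _).symm
  rw [h]
  have hcomp := Measurable.comp (g := fun p : (G.Route → ℝ) × Ω => G.clampCost p.1 p.2)
    G.measurable_clampCost (hf.prodMk hs)
  exact hcomp

theorem leadFlow {m : Ξ → G.Memory} (hm : G.MeasurableMemory m) {n : ℕ}
    (hv : ∀ ξ, (m ξ).IsValid n) {s : Ξ → Ω} (hs : Measurable s) :
    Measurable fun ξ => (m ξ).leadFlow linearWeight (n + 1) (s ξ) := by
  have hY := hm.score
  have hc := pathCost (hm.testFlow linearWeight (n + 1)) (fun ξ => (hv ξ).testFlow_mem_feasible) hs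
  have h : Measurable fun ξ => (m ξ).testScore linearWeight (n + 1) (s ξ) := by
    unfold Memory.testScore
    fun_prop
  exact hm.logit h

theorem recommendedFlow {m : Ξ → G.Memory} (hm : G.MeasurableMemory m) {n : ℕ}
    (hv : ∀ ξ, (m ξ).IsValid n) {s : Ξ → Ω} (hs : Measurable s) :
    Measurable fun ξ => (m ξ).recommendedFlow linearWeight (n + 1) (s ξ) :=
  hm.average (hm.leadFlow hv hs) _ _

theorem next {m : Ξ → G.Memory} (hm : G.MeasurableMemory m) {n : ℕ}
    (hv : ∀ ξ, (m ξ).IsValid n) {s₁ s₂ : Ξ → Ω} (hs₁ : Measurable s₁) (hs₂ : Measurable s₂) :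
    G.MeasurableMemory fun ξ => (m ξ).next linearWeight (n + 1) (s₁ ξ) (s₂ ξ) := by
  have ha := hm.anchor
  have hY := hm.score
  have hq := hm.sqSum
  have hl := hm.leadFlow hv hs₁
  have hc := pathCost (hm.testFlow linearWeight (n + 1)) (fun ξ => (hv ξ).testFlow_mem_feasible) hs₁
  have hc' := pathCost (hm.recommendedFlow hv hs₁)
    (fun ξ => (hv ξ).recommendedFlow_mem_feasible (s₁ ξ)) hs₂
  constructor <;> simp only [Memory.next] <;> fun_prop

end MeasurableMemory

variable {ω : ℕ → Phase → Ξ → Ω}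

/-- The σ-algebra on `Ξ` is arbitrary and only the states of the epochs already played need be
measurable. The lemma therefore also applies to the σ-algebra generated by the past, which is what
independence requires. -/
theorem measurableMemory_memory (n : ℕ) (hω : ∀ t ≤ n, ∀ φ, Measurable (ω t φ)) :
    G.MeasurableMemory fun ξ => G.memory linearWeight (fun t φ => ω t φ ξ) n := by
  induction n with
  | zero => exact ⟨measurable_const, measurable_const, measurable_const⟩
  | succ n ih =>
    exact (ih fun t ht => hω t (ht.trans n.le_succ)).next (fun ξ => G.memory_isValid _ n)
      (hω _ le_rfl Phase.test) (hω _ le_rfl Phase.recommend)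

theorem measurable_tstFlow (n : ℕ) (hω : ∀ t ≤ n, ∀ φ, Measurable (ω t φ)) :
    Measurable fun ξ => G.tstFlow (fun t φ => ω t φ ξ) n :=
  (G.measurableMemory_memory n hω).testFlow _ _

theorem measurable_ldFlow (n : ℕ) (hω : ∀ t ≤ n, ∀ φ, Measurable (ω t φ))
    (h1 : Measurable (ω (n + 1) Phase.test)) :
    Measurable fun ξ => G.ldFlow (fun t φ => ω t φ ξ) n :=
  (G.measurableMemory_memory n hω).leadFlow (fun _ => G.memory_isValid _ n) h1

theorem measurable_recFlow (n : ℕ) (hω : ∀ t ≤ n, ∀ φ, Measurable (ω t φ))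
    (h1 : Measurable (ω (n + 1) Phase.test)) :
    Measurable fun ξ => G.recFlow (fun t φ => ω t φ ξ) n :=
  (G.measurableMemory_memory n hω).recommendedFlow (fun _ => G.memory_isValid _ n) h1

end Measurability

/-! ### Independence of the current state from the past -/

section Independence

variable {Ξ : Type*} {mΞ : MeasurableSpace Ξ} {μ : Measure Ξ} {ω : ℕ → Phase → Ξ → Ω}

theorem measurable_of_mem {ι Ξ Ω : Type*} [mΩ : MeasurableSpace Ω] (ω : ι → Ξ → Ω) {J : Set ι}
    {j : ι} (hj : j ∈ J) : Measurable[⨆ i ∈ J, mΩ.comap (ω i)] (ω j) :=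
  measurable_iff_comap_le.2 (le_iSup₂ (f := fun i _ => mΩ.comap (ω i)) j hj)

theorem indepFun_tstFlow (hω : ∀ t φ, Measurable (ω t φ))
    (hind : iIndepFun (fun j : ℕ × Phase => ω j.1 j.2) μ) (k : ℕ) :
    IndepFun (fun ξ => G.tstFlow (fun t φ => ω t φ ξ) k) (ω (k + 1) Phase.test) μ := by
  refine indepFun_of_measurable_iSup_comap (ω := fun j : ℕ × Phase => ω j.1 j.2)
    (J := {j | j.1 ≤ k}) (j := (k + 1, Phase.test)) (fun j => hω j.1 j.2) hind (by simp) ?_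
  exact G.measurable_tstFlow k fun t ht φ =>
    measurable_of_mem (fun j : ℕ × Phase => ω j.1 j.2) (j := (t, φ)) ht

/-- Both flows depend on the past and on the test state of the current epoch, but not on its
recommendation state. Joint independence is needed since the martingale term multiplies the noise at
x^t by y^t - f. -/
theorem indepFun_recFlow_ldFlow (hω : ∀ t φ, Measurable (ω t φ))
    (hind : iIndepFun (fun j : ℕ × Phase => ω j.1 j.2) μ) (k : ℕ) :
    IndepFun (fun ξ => (G.recFlow (fun t φ => ω t φ ξ) k, G.ldFlow (fun t φ => ω t φ ξ) k))
      (ω (k + 1) Phase.recommend) μ := by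
  refine indepFun_of_measurable_iSup_comap (ω := fun j : ℕ × Phase => ω j.1 j.2)
    (J := {j | j.1 ≤ k ∨ j = (k + 1, Phase.test)}) (j := (k + 1, Phase.recommend))
    (fun j => hω j.1 j.2) hind (by simp) ?_
  have hpast := fun t (ht : t ≤ k) φ => measurable_of_mem (fun j : ℕ × Phase => ω j.1 j.2)
    (J := {j | j.1 ≤ k ∨ j = (k + 1, Phase.test)}) (j := (t, φ)) (Or.inl ht)
  have htest := measurable_of_mem (fun j : ℕ × Phase => ω j.1 j.2)
    (J := {j | j.1 ≤ k ∨ j = (k + 1, Phase.test)}) (j := (k + 1, Phase.test)) (Or.inr rfl)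
  exact Measurable.prodMk (G.measurable_recFlow k hpast htest) (G.measurable_ldFlow k hpast htest)

end Independence

/-! ### Moments of the noise -/

section Expectation

variable {Ξ : Type*} {mΞ : MeasurableSpace Ξ} {μ : Measure Ξ} [IsProbabilityMeasure μ]
  {ω : ℕ → Phase → Ξ → Ω}

theorem integrable_potential_recFlow (hω : ∀ t φ, Measurable (ω t φ)) (n : ℕ) :
    Integrable (fun ξ => G.potential (G.recFlow (fun t φ => ω t φ ξ) n)) μ := by
  obtain ⟨Φ, hΦ, heq⟩ := G.exists_continuous_potential_eq
  obtain ⟨B, hB⟩ := G.exists_abs_potential_le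
  have hm := G.measurable_recFlow n (fun t _ => hω t) (hω _ _)
  refine Integrable.of_bound (C := B) ?_
    (Filter.Eventually.of_forall fun ξ => hB _ (G.recFlow_mem_feasible _ n))
  simp only [heq _ (G.recFlow_mem_feasible _ n)]
  exact (hΦ.measurable.comp hm).aestronglyMeasurable

theorem integrable_norm_clampNoise_sq {X : Ξ → G.Route → ℝ} (hX : Measurable X) {W : Ξ → Ω}
    (hW : Measurable W) : Integrable (fun ξ => ‖G.clampNoise (X ξ) (W ξ)‖ ^ 2) μ := by
  obtain ⟨B, hB0, hB⟩ := G.exists_norm_clampNoise_le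
  refine Integrable.of_bound (C := B ^ 2)
    (((G.measurable_clampNoise.comp (hX.prodMk hW)).norm).pow_const 2).aestronglyMeasurable
    (Filter.Eventually.of_forall fun ξ => ?_)
  rw [Real.norm_of_nonneg (sq_nonneg _)]
  exact pow_le_pow_left₀ (norm_nonneg _) (hB _ _) 2

theorem integral_norm_clampNoise_sq_le {X : Ξ → G.Route → ℝ} (hX : Measurable X)
    (hXf : ∀ ξ, X ξ ∈ G.feasible) {W : Ξ → Ω} (hW : Measurable W) (hlaw : μ.map W = G.law)
    (hind : IndepFun X W μ) :
    ∫ ξ, ‖G.clampNoise (X ξ) (W ξ)‖ ^ 2 ∂μ ≤ G.noiseLevel ^ 2 := by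
  obtain ⟨B, hB0, hB⟩ := G.exists_norm_clampNoise_le
  rw [integral_comp_prodMk_of_indepFun (g := fun p => ‖G.clampNoise p.1 p.2‖ ^ 2) (B := B ^ 2)
    hX hW hlaw hind (G.measurable_clampNoise.norm.pow_const 2) fun p => by
      rw [abs_of_nonneg (sq_nonneg _)]
      exact pow_le_pow_left₀ (norm_nonneg _) (hB _ _) 2]
  have h : ∫ _ξ, G.noiseLevel ^ 2 ∂μ = G.noiseLevel ^ 2 := by simp
  rw [← h]
  exact integral_mono_of_nonneg
    (Filter.Eventually.of_forall fun ξ => integral_nonneg fun s => sq_nonneg _)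
    (integrable_const _) (Filter.Eventually.of_forall fun ξ =>
      G.variance_le_noiseLevel_sq (hXf ξ))

/-- The martingale property: with the flows frozen, the noise integrates to zero over an independent
state. -/
theorem integral_sum_clampNoise_mul {X Y : Ξ → G.Route → ℝ} (hX : Measurable X)
    (hY : Measurable Y) (hYf : ∀ ξ, Y ξ ∈ G.feasible) (f : G.Route → ℝ)
    {W : Ξ → Ω} (hW : Measurable W) (hlaw : μ.map W = G.law)
    (hind : IndepFun (fun ξ => (X ξ, Y ξ)) W μ) :
    Integrable (fun ξ => ∑ r, G.clampNoise (X ξ) (W ξ) r * (Y ξ r - f r)) μ ∧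
    ∫ ξ, ∑ r, G.clampNoise (X ξ) (W ξ) r * (Y ξ r - f r) ∂μ = 0 := by
  obtain ⟨B, hB0, hB⟩ := G.exists_norm_clampNoise_le
  have hterm : ∀ r, Integrable (fun ξ => G.clampNoise (X ξ) (W ξ) r * (Y ξ r - f r)) μ ∧
      ∫ ξ, G.clampNoise (X ξ) (W ξ) r * (Y ξ r - f r) ∂μ = 0 := by
    intro r
    -- The clamp changes nothing on feasible flows but makes the integrand bounded everywhere, as
    -- Fubini is applied to a globally bounded function.
    have hclamp : ∀ ξ, G.clamp (Y ξ r) = Y ξ r := fun ξ =>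
      G.clamp_of_mem ⟨(hYf ξ).1 r, by
        change _ ≤ G.totalDemand
        rw [← G.sum_of_mem_feasible (hYf ξ)]
        exact Finset.single_le_sum (fun r _ => (hYf ξ).1 r) (Finset.mem_univ r)⟩
    have hg : Measurable fun p : ((G.Route → ℝ) × (G.Route → ℝ)) × Ω =>
        G.clampNoise p.1.1 p.2 r * (G.clamp (p.1.2 r) - f r) := by
      refine Measurable.mul ?_ ?_
      · exact (measurable_pi_apply r).comp
          (G.measurable_clampNoise.comp ((measurable_fst.comp measurable_fst).prodMk measurable_snd))
      · exact (G.continuous_clamp.measurable.comp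
          ((measurable_pi_apply r).comp (measurable_snd.comp measurable_fst))).sub_const _
    have hb : ∀ p : ((G.Route → ℝ) × (G.Route → ℝ)) × Ω,
        |G.clampNoise p.1.1 p.2 r * (G.clamp (p.1.2 r) - f r)| ≤
          B * (G.totalDemand + |f r|) := by
      intro p
      rw [abs_mul]
      refine mul_le_mul ((norm_le_pi_norm _ r).trans (hB _ _)) ?_ (abs_nonneg _) hB0
      refine (abs_sub _ _).trans (add_le_add ?_ le_rfl)
      rw [abs_of_nonneg (G.clamp_mem _).1]
      exact (G.clamp_mem _).2
    have hint := integral_comp_prodMk_of_indepFun (hX.prodMk hY) hW hlaw hind hg hb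
    have hi : Integrable (fun ξ => G.clampNoise (X ξ) (W ξ) r * (G.clamp (Y ξ r) - f r)) μ :=
      Integrable.of_bound (hg.comp ((hX.prodMk hY).prodMk hW)).aestronglyMeasurable _
        (Filter.Eventually.of_forall fun ξ => hb ((X ξ, Y ξ), W ξ))
    simp only [hclamp] at hint hi
    refine ⟨hi, hint.trans ?_⟩
    simp only [integral_mul_const, integral_clampNoise, zero_mul, integral_zero]
  refine ⟨integrable_finsetSum _ fun r _ => (hterm r).1, ?_⟩
  rw [integral_finsetSum _ fun r _ => (hterm r).1]
  exact Finset.sum_eq_zero fun r _ => (hterm r).2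

end Expectation
end CongestionGame
end

/-! ### Constants and convergence rates -/

noncomputable section

namespace CongestionGame

variable {V E I Ω : Type*} [Fintype I] [MeasurableSpace Ω] (G : CongestionGame V E I Ω)

/-- The value of a potential difference from its weighted bound. -/
theorem le_two_mul_div_of_weight_mul_le {n : ℕ} {x B : ℝ} (hB : 0 ≤ B)
    (h : (∑ j ∈ Finset.range (n + 2), linearWeight j) * x ≤ B) :
    x ≤ 2 * B / ((n + 1 : ℕ) : ℝ) ^ 2 := by
  rw [sum_range_linearWeight] at h
  push_cast at h ⊢
  have hn : (0 : ℝ) < (n : ℝ) + 1 := by positivity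
  rw [le_div_iff₀ (by positivity)]
  -- For x ≥ 0 this is A_T = T(T + 1)/2 ≥ T²/2; for x ≤ 0 the claim follows from the sign of B.
  rcases le_total x 0 with hx | hx
  · nlinarith [mul_nonneg (neg_nonneg.2 hx) (sq_nonneg ((n : ℝ) + 1))]
  · nlinarith [mul_nonneg hx hn.le]

theorem noiseLevel_nonneg : 0 ≤ G.noiseLevel := Real.sqrt_nonneg _

section LogarithmicBounds

/-- A constant that depends only on the number of O/D pairs, the largest demand and the smoothness
modulus, and that dominates the constants of the convergence rates. -/
def rateConst (a L : ℝ) : ℝ := 1 + 130 * |a| + 16 * L * √a * (21 * |a|) ^ (3 / 2 : ℝ)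

theorem rateConst_pos (a : ℝ) {L : ℝ} (hL : 0 ≤ L) : 0 < rateConst a L := by
  unfold rateConst; positivity

theorem log_numPaths_gt (hP : 2 ≤ G.numPaths) : 0.69 < Real.log G.numPaths := by
  have h : Real.log 2 ≤ Real.log G.numPaths :=
    Real.log_le_log (by norm_num) (by exact_mod_cast hP)
  linarith [Real.log_two_gt_d9]

variable [Nonempty I]

theorem log_ratio_le (hP : 2 ≤ G.numPaths) :
    Real.log (G.numPaths * G.maxDemand / G.totalDemand) ≤ Real.log G.numPaths := by
  have hm := G.totalDemand_pos
  have hM := G.maxDemand_pos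
  have hP' : (0 : ℝ) < G.numPaths := by positivity
  refine Real.log_le_log (by positivity) ?_
  rw [div_le_iff₀ hm]
  exact mul_le_mul_of_nonneg_left G.maxDemand_le_totalDemand hP'.le

theorem constC_le (hP : 2 ≤ G.numPaths) :
    G.constC ≤ 21 * (Fintype.card I * G.maxDemand) * Real.log G.numPaths := by
  have h1 := G.log_ratio_le hP
  have h2 := G.log_numPaths_gt hP
  have ha : (0 : ℝ) ≤ Fintype.card I * G.maxDemand :=
    mul_nonneg (Nat.cast_nonneg _) G.maxDemand_pos.le
  rw [constC, mul_right_comm, mul_comm (21 : ℝ), mul_right_comm, mul_assoc _ _ (21 : ℝ)]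
  -- The constant 21 works because 13 ≤ 19 · 0.69.
  have h3 : 2 * Real.log (G.numPaths * G.maxDemand / G.totalDemand) + 13 ≤
      Real.log G.numPaths * 21 := by linarith
  nlinarith [mul_le_mul_of_nonneg_left h3 ha]

theorem constC'_le (hP : 2 ≤ G.numPaths) :
    G.constC' ≤ Fintype.card I * G.maxDemand * Real.log G.numPaths :=
  mul_le_mul G.totalDemand_le (G.log_ratio_le hP) G.log_ratio_nonneg
    (mul_nonneg (Nat.cast_nonneg _) G.maxDemand_pos.le)

theorem rate_le (hP : 2 ≤ G.numPaths) {L : ℝ} (hL : 0 ≤ L) :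
    2 * √2 * G.constC ≤
      rateConst (Fintype.card I * G.maxDemand) L * Real.log G.numPaths ^ (3 / 2 : ℝ) ∧
    16 * L * √(Fintype.card I * G.maxDemand) * G.constC ^ (3 / 2 : ℝ) + 2 * G.constC' ≤
      rateConst (Fintype.card I * G.maxDemand) L * Real.log G.numPaths ^ (3 / 2 : ℝ) := by
  have hl := G.log_numPaths_gt hP
  have hC := G.constC_le hP
  have hC' := G.constC'_le hP
  have ha : (0 : ℝ) ≤ Fintype.card I * G.maxDemand :=
    mul_nonneg (Nat.cast_nonneg _) G.maxDemand_pos.le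
  rw [rateConst, abs_of_nonneg ha]
  set a := (Fintype.card I : ℝ) * G.maxDemand
  set l := Real.log G.numPaths
  have hl0 : 0 < l := by linarith
  -- Since log P ≥ log 2 > 1/4, a linear term is absorbed by the power 3/2 at the cost of a factor
  -- 2.
  have hl32 : l ≤ 2 * l ^ (3 / 2 : ℝ) := by
    have he : l ^ (3 / 2 : ℝ) = l * √l := by
      rw [Real.sqrt_eq_rpow, ← Real.rpow_one_add' hl0.le (by norm_num)]
      norm_num
    have hs : 1 / 2 ≤ √l := Real.le_sqrt_of_sq_le (by linarith)
    rw [he]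
    nlinarith
  have hpow0 : 0 ≤ l ^ (3 / 2 : ℝ) := Real.rpow_nonneg hl0.le _
  have hX : 0 ≤ 16 * L * √a * (21 * a) ^ (3 / 2 : ℝ) := by positivity
  have hCp : G.constC ^ (3 / 2 : ℝ) ≤ (21 * a) ^ (3 / 2 : ℝ) * l ^ (3 / 2 : ℝ) := by
    rw [← Real.mul_rpow (by positivity) hl0.le]
    exact Real.rpow_le_rpow G.constC_pos.le hC (by norm_num)
  have hal := mul_le_mul_of_nonneg_left hl32 ha
  have hapow : 0 ≤ a * l ^ (3 / 2 : ℝ) := mul_nonneg ha hpow0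
  have hXl := mul_nonneg hX hpow0
  constructor
  -- With 2√2 ≤ 3 the factor is 3 · 21 · 2 = 126, which the 130 in `rateConst` covers.
  · have h2 : √2 ≤ (3 / 2 : ℝ) := Real.sqrt_le_iff.2 ⟨by norm_num, by norm_num⟩
    have := mul_le_mul_of_nonneg_right h2 G.constC_pos.le
    nlinarith
  · have := mul_le_mul_of_nonneg_left hCp (by positivity : 0 ≤ 16 * L * √a)
    nlinarith

theorem const_le_rateConst_mul (hP : 2 ≤ G.numPaths) {L : ℝ} (hL : 0 ≤ L) :
    G.constC ≤ rateConst (Fintype.card I * G.maxDemand) L * Real.log G.numPaths ∧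
    G.constC' ≤ rateConst (Fintype.card I * G.maxDemand) L * Real.log G.numPaths := by
  have hl : 0 ≤ Real.log G.numPaths := by linarith [G.log_numPaths_gt hP]
  have ha : (0 : ℝ) ≤ Fintype.card I * G.maxDemand :=
    mul_nonneg (Nat.cast_nonneg _) G.maxDemand_pos.le
  have hX : 0 ≤ 16 * L * √(Fintype.card I * G.maxDemand) *
    (21 * (Fintype.card I * G.maxDemand)) ^ (3 / 2 : ℝ) := by positivity
  rw [rateConst, abs_of_nonneg ha]
  constructor
  · exact (G.constC_le hP).trans (mul_le_mul_of_nonneg_right (by linarith) hl)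
  · exact (G.constC'_le hP).trans (mul_le_mul_of_nonneg_right (by linarith) hl)

theorem constC_rpow_nonneg {L : ℝ} (hL : 0 ≤ L) :
    0 ≤ 8 * L * √(Fintype.card I * G.maxDemand) * G.constC ^ (3 / 2 : ℝ) := by
  have := Real.rpow_nonneg G.constC_pos.le (3 / 2 : ℝ)
  positivity

end LogarithmicBounds

variable [Fintype E]

theorem recNoise_eq (s : ℕ → Phase → Ω) (k : ℕ) :
    G.recNoise s k = G.clampNoise (G.recFlow s k) (s (k + 1) Phase.recommend) :=
  (G.clampNoise_eq (G.recFlow_mem_feasible s k) _).symm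

theorem tstNoise_eq (s : ℕ → Phase → Ω) (k : ℕ) :
    G.tstNoise s k = G.clampNoise (G.tstFlow s k) (s (k + 1) Phase.test) :=
  (G.clampNoise_eq (G.tstFlow_mem_feasible s k) _).symm

section Expectation

variable {Ξ : Type*} {mΞ : MeasurableSpace Ξ} {μ : Measure Ξ} [IsProbabilityMeasure μ]
  {ω : ℕ → Phase → Ξ → Ω}

theorem recNoise_sq (hω : ∀ t φ, Measurable (ω t φ)) (hlaw : ∀ t φ, μ.map (ω t φ) = G.law)
    (hind : iIndepFun (fun j : ℕ × Phase => ω j.1 j.2) μ) (k : ℕ) :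
    Integrable (fun ξ => ‖G.recNoise (fun t φ => ω t φ ξ) k‖ ^ 2) μ ∧
    ∫ ξ, ‖G.recNoise (fun t φ => ω t φ ξ) k‖ ^ 2 ∂μ ≤ G.noiseLevel ^ 2 := by
  have hX := G.measurable_recFlow k (fun t _ => hω t) (hω _ _)
  simp only [recNoise_eq]
  exact ⟨G.integrable_norm_clampNoise_sq hX (hω _ _),
    G.integral_norm_clampNoise_sq_le hX (fun _ => G.recFlow_mem_feasible _ k) (hω _ _) (hlaw _ _)
      ((G.indepFun_recFlow_ldFlow hω hind k).comp measurable_fst measurable_id)⟩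

theorem tstNoise_sq (hω : ∀ t φ, Measurable (ω t φ)) (hlaw : ∀ t φ, μ.map (ω t φ) = G.law)
    (hind : iIndepFun (fun j : ℕ × Phase => ω j.1 j.2) μ) (k : ℕ) :
    Integrable (fun ξ => ‖G.tstNoise (fun t φ => ω t φ ξ) k‖ ^ 2) μ ∧
    ∫ ξ, ‖G.tstNoise (fun t φ => ω t φ ξ) k‖ ^ 2 ∂μ ≤ G.noiseLevel ^ 2 := by
  have hX := G.measurable_tstFlow k (fun t _ => hω t)
  simp only [tstNoise_eq]
  exact ⟨G.integrable_norm_clampNoise_sq hX (hω _ _),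
    G.integral_norm_clampNoise_sq_le hX (fun _ => G.tstFlow_mem_feasible _ k) (hω _ _) (hlaw _ _)
      (G.indepFun_tstFlow hω hind k)⟩

theorem noiseRegret_integral (hω : ∀ t φ, Measurable (ω t φ))
    (hlaw : ∀ t φ, μ.map (ω t φ) = G.law)
    (hind : iIndepFun (fun j : ℕ × Phase => ω j.1 j.2) μ) (f : G.Route → ℝ) (n : ℕ) :
    Integrable (fun ξ => G.noiseRegret (fun t φ => ω t φ ξ) f n) μ ∧
    ∫ ξ, G.noiseRegret (fun t φ => ω t φ ξ) f n ∂μ = 0 := by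
  have h := fun k => G.integral_sum_clampNoise_mul (μ := μ)
    (G.measurable_recFlow k (fun t _ => hω t) (hω _ _))
    (G.measurable_ldFlow k (fun t _ => hω t) (hω _ _)) (fun _ => G.ldFlow_mem_feasible _ k) f
    (hω _ _) (hlaw _ _) (G.indepFun_recFlow_ldFlow hω hind k)
  simp only [noiseRegret, recNoise_eq]
  refine ⟨integrable_finsetSum _ fun k _ => (h k).1.const_mul _, ?_⟩
  rw [integral_finsetSum _ fun k _ => (h k).1.const_mul _]
  refine Finset.sum_eq_zero fun k _ => ?_
  rw [integral_const_mul, (h k).2, mul_zero]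

/-- Every squared weight is bounded crudely by n², which gives the factor n³. -/
theorem noiseSum_integral (hω : ∀ t φ, Measurable (ω t φ))
    (hlaw : ∀ t φ, μ.map (ω t φ) = G.law)
    (hind : iIndepFun (fun j : ℕ × Phase => ω j.1 j.2) μ) (n : ℕ) :
    Integrable (fun ξ => G.noiseSum (fun t φ => ω t φ ξ) n) μ ∧
    ∫ ξ, G.noiseSum (fun t φ => ω t φ ξ) n ∂μ ≤ 2 * G.noiseLevel ^ 2 * (n : ℝ) ^ 3 := by
  have hr := G.recNoise_sq hω hlaw hind
  have ht := G.tstNoise_sq hω hlaw hind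
  have hi : ∀ k, Integrable (fun ξ => ((k + 1 : ℕ) : ℝ) ^ 2 *
      (‖G.recNoise (fun t φ => ω t φ ξ) k‖ ^ 2 + ‖G.tstNoise (fun t φ => ω t φ ξ) k‖ ^ 2)) μ :=
    fun k => ((hr k).1.add (ht k).1).const_mul _
  simp only [noiseSum]
  refine ⟨integrable_finsetSum _ fun k _ => hi k, ?_⟩
  rw [integral_finsetSum _ fun k _ => hi k]
  have hterm : ∀ k ∈ Finset.range n, ∫ ξ, ((k + 1 : ℕ) : ℝ) ^ 2 *
      (‖G.recNoise (fun t φ => ω t φ ξ) k‖ ^ 2 + ‖G.tstNoise (fun t φ => ω t φ ξ) k‖ ^ 2) ∂μ ≤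
      (n : ℝ) ^ 2 * (2 * G.noiseLevel ^ 2) := by
    intro k hk
    rw [integral_const_mul, integral_add (hr k).1 (ht k).1]
    have hkn : ((k + 1 : ℕ) : ℝ) ≤ n := by exact_mod_cast Finset.mem_range.1 hk
    refine mul_le_mul (pow_le_pow_left₀ (Nat.cast_nonneg _) hkn 2) ?_ ?_ (by positivity)
    · linarith [(hr k).2, (ht k).2]
    · exact add_nonneg (integral_nonneg fun _ => sq_nonneg _) (integral_nonneg fun _ => sq_nonneg _)
  refine (Finset.sum_le_sum hterm).trans (le_of_eq ?_)
  rw [Finset.sum_const, Finset.card_range, nsmul_eq_mul]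
  ring

theorem integrable_gap_recFlow (hω : ∀ t φ, Measurable (ω t φ)) (n : ℕ) :
    Integrable (fun ξ => G.gap (G.recFlow (fun t φ => ω t φ ξ) n)) μ :=
  (G.integrable_potential_recFlow hω n).sub (integrable_const _)

variable [Nonempty I]

theorem integral_gap_recFlow_le {L : ℝ} (hL : 0 ≤ L) (hG : G.IsSmoothWith L)
    (hω : ∀ t φ, Measurable (ω t φ)) (hlaw : ∀ t φ, μ.map (ω t φ) = G.law)
    (hind : iIndepFun (fun j : ℕ × Phase => ω j.1 j.2) μ) (n : ℕ) :
    ∫ ξ, G.gap (G.recFlow (fun t φ => ω t φ ξ) n) ∂μ ≤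
      2 * √2 * G.constC * G.noiseLevel / √((n + 1 : ℕ) : ℝ) +
        (16 * L * √(Fintype.card I * G.maxDemand) * G.constC ^ (3 / 2 : ℝ) + 2 * G.constC') /
          ((n + 1 : ℕ) : ℝ) ^ 2 := by
  have hΦ := G.integrable_potential_recFlow (μ := μ) hω n
  obtain ⟨hNi, hN⟩ := G.noiseSum_integral hω hlaw hind (n + 1)
  have hσ := G.noiseLevel_nonneg
  have hC := G.constC_pos
  have hC' := G.constC'_nonneg
  have hQ := G.constC_rpow_nonneg hL
  have hN0 : ∀ ξ, 0 ≤ 4 * G.noiseSum (fun t φ => ω t φ ξ) (n + 1) := fun ξ =>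
    mul_nonneg (by norm_num) (Finset.sum_nonneg fun k _ => by positivity)
  obtain ⟨hSi, hS⟩ := integral_sqrt_le_sqrt_integral (hNi.const_mul 4) hN0
  rw [integral_const_mul] at hS
  set T : ℝ := ((n + 1 : ℕ) : ℝ) with hT
  have hTpos : 0 < T := by positivity
  have hsT := Real.sqrt_pos.2 hTpos
  have hsT2 := Real.sq_sqrt hTpos.le
  -- Jensen's inequality: the root of 4 · 2σ²T³.
  have hS' : ∫ ξ, √(4 * G.noiseSum (fun t φ => ω t φ ξ) (n + 1)) ∂μ ≤
      2 * √2 * G.noiseLevel * (T * √T) := by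
    refine hS.trans (Real.sqrt_le_iff.2 ⟨by positivity, ?_⟩)
    have h2 : √2 ^ 2 = (2 : ℝ) := Real.sq_sqrt (by norm_num)
    have : (2 * √2 * G.noiseLevel * (T * √T)) ^ 2 = 4 * (2 * G.noiseLevel ^ 2 * T ^ 3) := by
      rw [mul_pow, mul_pow, mul_pow, mul_pow, h2, hsT2]; ring
    rw [this]
    linarith
  set B : ℝ := G.constC' + (G.constC / 2 * (2 * √2 * G.noiseLevel * (T * √T)) +
    8 * L * √(Fintype.card I * G.maxDemand) * G.constC ^ (3 / 2 : ℝ)) with hBdef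
  have hB : 0 ≤ B := by positivity
  -- The competitor is fixed before the expectation is taken, since the martingale term has mean
  -- zero only for deterministic f. The infimum over f follows afterwards.
  have hbound : ∀ f ∈ G.feasible,
      ∫ ξ, G.potential (G.recFlow (fun t φ => ω t φ ξ) n) ∂μ - G.potential f ≤ 2 * B / T ^ 2 := by
    intro f hf
    refine le_two_mul_div_of_weight_mul_le hB ?_
    obtain ⟨hRi, hR⟩ := G.noiseRegret_integral hω hlaw hind f (n + 1)
    have hdi : Integrable (fun ξ => G.potential (G.recFlow (fun t φ => ω t φ ξ) n) -
      G.potential f) μ := hΦ.sub (integrable_const _)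
    have hAi := hdi.const_mul (∑ j ∈ Finset.range (n + 2), linearWeight j)
    have hrs : Integrable (fun ξ =>
        G.constC / 2 * √(4 * G.noiseSum (fun t φ => ω t φ ξ) (n + 1)) +
        8 * L * √(Fintype.card I * G.maxDemand) * G.constC ^ (3 / 2 : ℝ)) μ :=
      (hSi.const_mul _).add (integrable_const _)
    have hri : Integrable (fun ξ => G.constC' +
        (G.constC / 2 * √(4 * G.noiseSum (fun t φ => ω t φ ξ) (n + 1)) +
        8 * L * √(Fintype.card I * G.maxDemand) * G.constC ^ (3 / 2 : ℝ))) μ :=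
      (integrable_const _).add hrs
    have h := integral_mono (hAi.add hRi) hri fun ξ =>
      G.weight_mul_potential_sub_add_noiseRegret_le hL hG (fun t φ => ω t φ ξ) hf n
    simp only [Pi.add_apply] at h
    rw [integral_add hAi hRi, hR, add_zero, integral_const_mul,
      integral_sub hΦ (integrable_const _), integral_add (integrable_const _) hrs,
      integral_add (hSi.const_mul _) (integrable_const _), integral_const_mul] at h
    simp only [integral_const, probReal_univ, one_smul] at h
    refine h.trans ?_
    rw [hBdef]
    gcongr
  have hgap : ∫ ξ, G.gap (G.recFlow (fun t φ => ω t φ ξ) n) ∂μ ≤ 2 * B / T ^ 2 := by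
    have hinf : ∫ ξ, G.potential (G.recFlow (fun t φ => ω t φ ξ) n) ∂μ - 2 * B / T ^ 2 ≤
        sInf (G.potential '' G.feasible) := by
      refine le_csInf ⟨_, _, G.logit_mem_feasible 0, rfl⟩ ?_
      rintro _ ⟨f, hf, rfl⟩
      linarith [hbound f hf]
    simp only [gap]
    rw [integral_sub hΦ (integrable_const _)]
    simp only [integral_const, probReal_univ, one_smul]
    linarith
  refine hgap.trans (le_of_eq ?_)
  have e : 2 * √2 * G.constC * G.noiseLevel / √T =
      2 * (G.constC / 2 * (2 * √2 * G.noiseLevel * (T * √T))) / T ^ 2 := by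
    rw [div_eq_div_iff hsT.ne' (by positivity)]
    linear_combination (-2 * √2 * G.constC * G.noiseLevel * T) * hsT2
  rw [e, hBdef]
  ring

/-- If σ = 0, each noise vector has zero second moment. Almost surely the countably many noise
vectors all vanish, and the pathwise bound holds for all epochs at once. -/
theorem gap_recFlow_le_of_noiseLevel_eq_zero {L : ℝ} (hL : 0 ≤ L) (hG : G.IsSmoothWith L)
    (hω : ∀ t φ, Measurable (ω t φ)) (hlaw : ∀ t φ, μ.map (ω t φ) = G.law)
    (hind : iIndepFun (fun j : ℕ × Phase => ω j.1 j.2) μ) (hσ : G.noiseLevel = 0) :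
    ∀ᵐ ξ ∂μ, ∀ n : ℕ, G.gap (G.recFlow (fun t φ => ω t φ ξ) n) ≤
      (16 * L * √(Fintype.card I * G.maxDemand) * G.constC ^ (3 / 2 : ℝ) + 2 * G.constC') /
        ((n + 1 : ℕ) : ℝ) ^ 2 := by
  have hzero : ∀ {X : Ξ → G.Route → ℝ}, Integrable (fun ξ => ‖X ξ‖ ^ 2) μ →
      ∫ ξ, ‖X ξ‖ ^ 2 ∂μ ≤ G.noiseLevel ^ 2 → ∀ᵐ ξ ∂μ, X ξ = 0 := by
    intro X hX h
    rw [hσ, zero_pow two_ne_zero] at h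
    have h0 := (integral_eq_zero_iff_of_nonneg (fun _ => sq_nonneg _) hX).1
      (h.antisymm (integral_nonneg fun _ => sq_nonneg _))
    filter_upwards [h0] with ξ hξ
    simpa using hξ
  have hr : ∀ᵐ ξ ∂μ, ∀ k, G.recNoise (fun t φ => ω t φ ξ) k = 0 := ae_all_iff.2 fun k =>
    hzero (G.recNoise_sq hω hlaw hind k).1 (G.recNoise_sq hω hlaw hind k).2
  have ht : ∀ᵐ ξ ∂μ, ∀ k, G.tstNoise (fun t φ => ω t φ ξ) k = 0 := ae_all_iff.2 fun k =>
    hzero (G.tstNoise_sq hω hlaw hind k).1 (G.tstNoise_sq hω hlaw hind k).2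
  filter_upwards [hr, ht] with ξ hr ht n
  refine G.gap_le_of_forall fun f hf => ?_
  have h := G.weight_mul_potential_sub_add_noiseRegret_le hL hG (fun t φ => ω t φ ξ) hf n
  simp only [noiseRegret, noiseSum, hr, ht, Pi.zero_apply, zero_mul, norm_zero, ne_eq,
    OfNat.ofNat_ne_zero, not_false_eq_true, zero_pow, add_zero, mul_zero, Finset.sum_const_zero,
    Real.sqrt_zero, zero_add] at h
  refine (le_two_mul_div_of_weight_mul_le
    (add_nonneg G.constC'_nonneg (G.constC_rpow_nonneg hL)) h).trans (le_of_eq ?_)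
  ring

end Expectation

end CongestionGame

end

/-! ### The theorem -/

open CongestionGame in
theorem mainTheorem1 (N : ℕ) (M L : ℝ) (hL : 0 ≤ L) :
    ∃ K : ℝ, 0 < K ∧
      ∀ {V E I Ω Ξ : Type*} [Fintype E] [Fintype I] [Nonempty I] [MeasurableSpace Ω]
        [MeasurableSpace Ξ] (G : CongestionGame V E I Ω) (μ : Measure Ξ) [IsProbabilityMeasure μ]
        (ω : ℕ → Phase → Ξ → Ω),
        Fintype.card I = N → G.maxDemand = M → G.IsSmoothWith L →
        (∀ t φ, Measurable (ω t φ)) → (∀ t φ, μ.map (ω t φ) = G.law) →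
        iIndepFun (fun j : ℕ × Phase => ω j.1 j.2) μ →
        (∀ T : ℕ, 1 ≤ T →
          Integrable (fun ξ => G.gap (G.adaWeight (fun t => (t : ℝ)) (fun t φ => ω t φ ξ) T)) μ ∧
          ∫ ξ, G.gap (G.adaWeight (fun t => (t : ℝ)) (fun t φ => ω t φ ξ) T) ∂μ ≤
            2 * √2 * G.constC * G.noiseLevel / √(T : ℝ) +
              (16 * L * √((N : ℝ) * M) * G.constC ^ (3 / 2 : ℝ) + 2 * G.constC') / (T : ℝ) ^ 2) ∧
        (G.noiseLevel = 0 → ∀ᵐ ξ ∂μ, ∀ T : ℕ, 1 ≤ T →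
          G.gap (G.adaWeight (fun t => (t : ℝ)) (fun t φ => ω t φ ξ) T) ≤
            (16 * L * √((N : ℝ) * M) * G.constC ^ (3 / 2 : ℝ) + 2 * G.constC') / (T : ℝ) ^ 2) ∧
        0 < G.constC ∧ 0 ≤ G.constC' ∧
        (2 ≤ G.numPaths →
          G.constC ≤ K * Real.log G.numPaths ∧
          G.constC' ≤ K * Real.log G.numPaths ∧
          (∀ T : ℕ, 1 ≤ T →
            ∫ ξ, G.gap (G.adaWeight (fun t => (t : ℝ)) (fun t φ => ω t φ ξ) T) ∂μ ≤
              K * Real.log G.numPaths ^ (3 / 2 : ℝ) *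
                (G.noiseLevel / √(T : ℝ) + 1 / (T : ℝ) ^ 2)) ∧
          (G.noiseLevel = 0 → ∀ᵐ ξ ∂μ, ∀ T : ℕ, 1 ≤ T →
            G.gap (G.adaWeight (fun t => (t : ℝ)) (fun t φ => ω t φ ξ) T) ≤
              K * Real.log G.numPaths ^ (3 / 2 : ℝ) / (T : ℝ) ^ 2)) := by
  -- The constant is chosen before the game, when M may still be negative; the absolute values in
  -- `rateConst` keep it positive in that case.
  refine ⟨rateConst (N * M) L, rateConst_pos _ hL, ?_⟩
  intro V E I Ω Ξ _ _ _ _ _ G μ _ ω hN hM hG hω hlaw hind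
  subst hN hM
  have hexp : ∀ T : ℕ, 1 ≤ T →
      ∫ ξ, G.gap (G.adaWeight (fun t => (t : ℝ)) (fun t φ => ω t φ ξ) T) ∂μ ≤
        2 * √2 * G.constC * G.noiseLevel / √(T : ℝ) +
          (16 * L * √((Fintype.card I : ℝ) * G.maxDemand) * G.constC ^ (3 / 2 : ℝ) +
            2 * G.constC') / (T : ℝ) ^ 2 := by
    rintro (_ | n) hT
    · omega
    -- By definition, `recFlow` at index n is the flow that `adaWeight` recommends in epoch n + 1.
    · exact G.integral_gap_recFlow_le hL hG hω hlaw hind n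
  have has : G.noiseLevel = 0 → ∀ᵐ ξ ∂μ, ∀ T : ℕ, 1 ≤ T →
      G.gap (G.adaWeight (fun t => (t : ℝ)) (fun t φ => ω t φ ξ) T) ≤
        (16 * L * √((Fintype.card I : ℝ) * G.maxDemand) * G.constC ^ (3 / 2 : ℝ) +
          2 * G.constC') / (T : ℝ) ^ 2 := by
    intro hσ
    filter_upwards [G.gap_recFlow_le_of_noiseLevel_eq_zero hL hG hω hlaw hind hσ] with ξ hξ
    rintro (_ | n) hT
    · omega
    · exact hξ n
  refine ⟨fun T hT => ⟨?_, hexp T hT⟩, has, G.constC_pos, G.constC'_nonneg, fun hP =>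
    ⟨(G.const_le_rateConst_mul hP hL).1, (G.const_le_rateConst_mul hP hL).2, fun T hT => ?_,
      fun hσ => ?_⟩⟩
  · obtain ⟨n, rfl⟩ := Nat.exists_eq_add_of_le' hT
    exact G.integrable_gap_recFlow hω n
  · refine (hexp T hT).trans ?_
    obtain ⟨h1, h2⟩ := G.rate_le hP hL
    have hσ := G.noiseLevel_nonneg
    rw [mul_add, mul_div_assoc, mul_one_div]
    gcongr
  · filter_upwards [has hσ] with ξ hξ T hT
    refine (hξ T hT).trans ?_
    gcongr
    exact (G.rate_le hP hL).2
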